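/- Let $M$ be a smooth manifold, $\tau$ a nowhere-vanishing smooth $1$-form and $\omega$ a smooth $2$-form on $M$. The class of a pair $(\alpha,\beta)$ of a $1$-form and a $2$-form at a point $x$ is the codimension in $T_xM$ of $\operatorname{Ker}\alpha_x\cap\operatorname{Ker}\beta_x$, where $\operatorname{Ker}\alpha_x=\{v\in T_xM : \alpha_x(v)=0\}$ and $\operatorname{Ker}\beta_x=\{v\in T_xM : \iota_v\beta_x=0\}$. Let $r\ge 0$ be an integer and suppose that $(\tau,\omega)$ has class $2r+2$ at every point of $M$. A Liouville vector field of $(\tau,\omega)$ is a smooth vector field $\Delta$ on $M$ with $\iota_\Delta\omega=\tau$. Suppose that * the distribution $\operatorname{Ker}\omega$ is integrable, that is, through every point of $M$ passes an (immersed) integral manifold of $\operatorname{Ker}\omega$, whose tangent space at each of its points $y$ is $\operatorname{Ker}\omega_y$; and * for every Liouville vector field $\Delta$ of $(\tau,\omega)$ and every smooth vector field $\Gamma$ on $M$ with values in $\operatorname{Ker}\omega$, the Lie bracket $[\Delta,\Gamma]$ takes values in $\operatorname{Ker}\omega$. Then every point of $M$ has an open neighbourhood $V$ and a nowhere-vanishing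 function $g\in C^\infty(V)$ such that the pair $(g\tau,\ \mathrm{d}g\wedge\tau+g\,\omega)$ has class $2r+1$ at every point of $V$. -/

import Mathlib

open Set Module
open scoped Manifold ContDiff

noncomputable section

namespace Doublet

section LinearAlgebra

variable {T : Type*} [AddCommGroup T] [Module ℝ T] [TopologicalSpace T]
  [IsTopologicalAddGroup T] [ContinuousSMul ℝ T]

/-- The exterior product of two covectors,
`(a ∧ b) (v, w) = a v * b w - b v * a w`, as a bilinear form. -/
def wedge (a b : T →L[ℝ] ℝ) : T →L[ℝ] T →L[ℝ] ℝ :=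
  a.smulRight b - b.smulRight a

/-- The kernel `{v | ι_v B = 0}` of a bilinear form, where `ι_v B = B v`. -/
def kernel (B : T →L[ℝ] T →L[ℝ] ℝ) : Submodule ℝ T where
  carrier := {v | ∀ w, B v w = 0}
  add_mem' := by
    intro v v' hv hv' w
    simp [hv w, hv' w]
  zero_mem' := by
    intro w
    simp
  smul_mem' := by
    intro c v hv w
    simp [hv w]

/-- The kernel of a covector. -/
def kernelCovector (a : T →L[ℝ] ℝ) : Submodule ℝ T where
  carrier := {v | a v = 0}
  add_mem' := by
    intro v v' hv hv'
    simp_all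
  zero_mem' := by simp
  smul_mem' := by
    intro c v hv
    simp_all

/-- The class of the pair `(a, B)`: the codimension of `Ker a ∩ Ker B`. -/
def pairClass (a : T →L[ℝ] ℝ) (B : T →L[ℝ] T →L[ℝ] ℝ) : ℕ :=
  finrank ℝ (T ⧸ (kernelCovector a ⊓ kernel B))

end LinearAlgebra

section Manifold

variable (m : ℕ) (M : Type*) [TopologicalSpace M] [ChartedSpace (EuclideanSpace ℝ (Fin m)) M]
  [IsManifold (𝓡 m) ∞ M]

/-- Smooth differential `1`-forms: smooth sections of the cotangent bundle. -/
structure OneForm where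
  toFun : ∀ x : M, TangentSpace (𝓡 m) x →L[ℝ] ℝ
  smooth : ContMDiff (𝓡 m) ((𝓡 m).prod 𝓘(ℝ, EuclideanSpace ℝ (Fin m) →L[ℝ] ℝ)) ∞
    (fun x => Bundle.TotalSpace.mk' (EuclideanSpace ℝ (Fin m) →L[ℝ] ℝ)
      (E := fun x : M => TangentSpace (𝓡 m) x →L[ℝ] ℝ) x (toFun x))

/-- Smooth differential `2`-forms: smooth sections of the bundle of bilinear forms on the tangent
spaces with alternating values. -/
structure TwoForm where
  toFun : ∀ x : M, TangentSpace (𝓡 m) x →L[ℝ] TangentSpace (𝓡 m) x →L[ℝ] ℝ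
  alternating : ∀ (x : M) (v : TangentSpace (𝓡 m) x), toFun x v v = 0
  smooth : ContMDiff (𝓡 m) ((𝓡 m).prod
      𝓘(ℝ, EuclideanSpace ℝ (Fin m) →L[ℝ] EuclideanSpace ℝ (Fin m) →L[ℝ] ℝ)) ∞
    (fun x => Bundle.TotalSpace.mk'
      (EuclideanSpace ℝ (Fin m) →L[ℝ] EuclideanSpace ℝ (Fin m) →L[ℝ] ℝ)
      (E := fun x : M => TangentSpace (𝓡 m) x →L[ℝ] TangentSpace (𝓡 m) x →L[ℝ] ℝ) x (toFun x))

variable {m M}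

/-- `X` is a smooth vector field on `M`. -/
def IsSmoothVectorField (X : ∀ x : M, TangentSpace (𝓡 m) x) : Prop :=
  ContMDiff (𝓡 m) (𝓡 m).tangent ∞ (fun x => (⟨x, X x⟩ : TangentBundle (𝓡 m) M))

/-- `(τ, Ω)` has constant class `k`, that is, it is a doublet of class `k`. -/
def IsDoubletOfClass (τ : OneForm m M) (Ω : TwoForm m M) (k : ℕ) : Prop :=
  ∀ x : M, pairClass (τ.toFun x) (Ω.toFun x) = k

/-- `Δ` is a Liouville vector field of `(τ, Ω)`: a smooth vector field with `ι_Δ Ω = τ`. -/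
def IsLiouville (τ : OneForm m M) (Ω : TwoForm m M) (Δ : ∀ x : M, TangentSpace (𝓡 m) x) : Prop :=
  IsSmoothVectorField Δ ∧
    ∀ (x : M) (w : TangentSpace (𝓡 m) x), Ω.toFun x (Δ x) w = τ.toFun x w

/-- The distribution `D` is integrable: through every point `x` passes an integral manifold of
`D`, given by a smooth immersion `φ` of an open neighbourhood `U` of `0` in some `ℝ^k` with
`φ 0 = x`, whose tangent space at each of its points `φ u` is the whole of `D (φ u)`. -/
def IsIntegrable (D : ∀ x : M, Submodule ℝ (TangentSpace (𝓡 m) x)) : Prop :=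
  ∀ x : M, ∃ (k : ℕ) (U : Set (EuclideanSpace ℝ (Fin k))) (φ : EuclideanSpace ℝ (Fin k) → M),
    IsOpen U ∧ 0 ∈ U ∧ φ 0 = x ∧ ContMDiffOn (𝓡 k) (𝓡 m) ∞ φ U ∧
    ∀ u ∈ U, Function.Injective (mfderiv (𝓡 k) (𝓡 m) φ u) ∧
      ∀ v : TangentSpace (𝓡 m) (φ u), v ∈ D (φ u) ↔ ∃ a, mfderiv (𝓡 k) (𝓡 m) φ u a = v

/-- The differential of a real function at `x`, as a covector. -/
def differential (g : M → ℝ) (x : M) : TangentSpace (𝓡 m) x →L[ℝ] ℝ :=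
  mfderiv (𝓡 m) 𝓘(ℝ, ℝ) g x

end Manifold

end Doublet

end

/-! An alternating form has even rank, so if `τ` were nonzero somewhere on `Ker ω` the class of the
pair would be odd. Hence `Ker ω ⊆ Ker τ`, the class is the rank of `ω`, this rank is constant, and
the equation `ι_Δ ω = τ` has smooth local solutions. If `dg` vanishes on `Ker ω` and `dg Δ = -g`,
the common kernel of the rescaled pair is `Ker ω ⊕ ℝΔ`, one dimension larger than before
(`pairClass_rescale`). With `g = exp f` it remains to find `f` with `df = 0` on `Ker ω` and `df Δ =
-1`.

Such an `f` is a flow-time coordinate once the fields involved commute. In a chart, fix a projection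
`P` onto `Ker ω` at the centre, and normalize a frame `Y` of `Ker ω` by `P Y = id` and a Liouville
field by `P Δ = 0` (`exists_adapted_frame`). Integrability and the bracket hypothesis put all
brackets of these fields in `Ker ω`. Since the fields have constant image under `P`, the brackets
also lie in `Ker P`, and `Ker ω ∩ Ker P = 0`; so the fields commute
(`frame_comm_of_integral_manifold`, `frame_comm_of_lieBracket`). The bracket hypothesis concerns
global fields; partitions of unity make it local, because Liouville fields and kernel fields are cut
out by convex fibrewise conditions (`lieBracket_mem_kernel`).

Commuting independent fields are straightened by their joint flow, started on a transversal
(`exists_first_integral`). The flow and its smoothness come from the inverse function theorem on the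
Banach space of curves `[0,1] → E` (`exists_commuting_flow`). -/

namespace Doublet

open Filter Topology MeasureTheory

/-! ### Smoothness of postcomposition on spaces of curves. -/

section Nemytskii

universe u

variable {I : Type*} [TopologicalSpace I] [CompactSpace I]

/-- Pointwise application of a continuous family of linear maps, as a continuous linear map into
the space of operators between spaces of continuous maps. -/
noncomputable def pointwiseCLM {E F : Type*} [NormedAddCommGroup E] [NormedSpace ℝ E]
    [NormedAddCommGroup F] [NormedSpace ℝ F] :
    C(I, E →L[ℝ] F) →L[ℝ] C(I, E) →L[ℝ] C(I, F) :=
  LinearMap.mkContinuous₂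
    (LinearMap.mk₂ ℝ 
      (fun (A : C(I, E →L[ℝ] F)) (v : C(I, E)) =>
        (⟨fun t => A t (v t), by fun_prop⟩ : C(I, F)))
      (fun _ _ _ => by ext; simp) (fun _ _ _ => by ext; simp)
      (fun _ _ _ => by ext; simp) (fun _ _ _ => by ext; simp)) 1
    (fun A v => by
      rw [ContinuousMap.norm_le _ (by positivity)]
      intro t
      rw [one_mul]
      exact ((A t).le_opNorm _).trans (by
        gcongr
        · exact A.norm_coe_le_norm t
        · exact v.norm_coe_le_norm t))

@[simp] lemma pointwiseCLM_apply {E F : Type*} [NormedAddCommGroup E] [NormedSpace ℝ E]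
    [NormedAddCommGroup F] [NormedSpace ℝ F] (A : C(I, E →L[ℝ] F)) (v : C(I, E)) (t : I) :
    pointwiseCLM A v t = A t (v t) := rfl

/-- Since `I` is compact, `h'.comp` is continuous in the sup norm, so `h'` varies by at most `ε`
along every segment from `α t` to `α t + v t`, uniformly in `t`. The mean value inequality then
bounds the error by `ε * ‖v‖`. -/
lemma hasFDerivAt_postcomp {E F : Type*} [NormedAddCommGroup E] [NormedSpace ℝ E]
    [NormedAddCommGroup F] [NormedSpace ℝ F] (h : C(E, F)) (h' : C(E, E →L[ℝ] F))
    (hh : ∀ x, HasFDerivAt h (h' x) x) (α : C(I, E)) :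
    HasFDerivAt (fun α : C(I, E) => h.comp α) (pointwiseCLM (h'.comp α)) α := by
  rw [hasFDerivAt_iff_isLittleO_nhds_zero, Asymptotics.isLittleO_iff]
  intro ε hε
  have hc : ContinuousAt (fun β : C(I, E) => h'.comp β) α :=
    (ContinuousMap.continuous_postcomp h').continuousAt
  obtain ⟨δ, hδ, hδ'⟩ := (Metric.continuousAt_iff (α := C(I, E)) (β := C(I, E →L[ℝ] F))).1 hc ε hε
  filter_upwards [Metric.ball_mem_nhds (0 : C(I, E)) hδ] with v hv
  rw [ContinuousMap.norm_le _ (by positivity)]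
  intro t
  have key : ∀ x ∈ segment ℝ (α t) (α t + v t), ‖h' x - h' (α t)‖ ≤ ε := by
    intro x hx
    rw [segment_eq_image'] at hx
    obtain ⟨s, hs, rfl⟩ := hx
    have hd : dist (α + s • v) α < δ := by
      rw [dist_eq_norm, add_sub_cancel_left, norm_smul, Real.norm_of_nonneg hs.1]
      have : ‖v‖ < δ := by simpa using hv
      nlinarith [norm_nonneg v, hs.2]
    have h1 := (hδ' hd).le
    have h2 := (ContinuousMap.dist_apply_le_dist t).trans h1
    simpa [dist_eq_norm] using h2
  have := (convex_segment (α t) (α t + v t)).norm_image_sub_le_of_norm_hasFDerivWithin_le'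
    (φ := h' (α t)) (fun x _ => (hh x).hasFDerivWithinAt) key
    (left_mem_segment ℝ _ _) (right_mem_segment ℝ _ _)
  simp only [add_sub_cancel_left] at this
  exact this.trans (mul_le_mul_of_nonneg_left (v.norm_coe_le_norm t) hε.le)

/-- The derivative of postcomposition by `h` is postcomposition by `fderiv ℝ h` followed by the
linear map `pointwiseCLM`. The induction therefore replaces `F` by `E →L[ℝ] F`, whence the inner
quantifiers and the common universe. -/
lemma contDiff_postcomp_nat (n : ℕ) : ∀ {E F : Type u} [NormedAddCommGroup E] [NormedSpace ℝ E]
    [NormedAddCommGroup F] [NormedSpace ℝ F] (h : C(E, F)), ContDiff ℝ n h →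
    ContDiff ℝ n (fun α : C(I, E) => h.comp α) := by
  induction n with
  | zero =>
    intro E F _ _ _ _ h _
    exact contDiff_zero.2 (ContinuousMap.continuous_postcomp h)
  | succ n ih =>
    intro E F _ _ _ _ h hh
    have hc : ContDiff ℝ n (fderiv ℝ h) := hh.fderiv_right (by norm_cast)
    let h' : C(E, E →L[ℝ] F) := ⟨fderiv ℝ h, hc.continuous⟩
    have hd : ∀ x, HasFDerivAt h (h' x) x := fun x =>
      (hh.differentiable (by simp) x).hasFDerivAt
    refine contDiff_succ_iff_hasFDerivAt.2 ⟨fun α => pointwiseCLM (h'.comp α), ?_,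
      fun α => hasFDerivAt_postcomp h h' hd α⟩
    exact (pointwiseCLM (I := I) (E := E) (F := F)).contDiff.comp (ih h' hc)

/-- Composition with a smooth map is a smooth operation on continuous maps. -/
lemma contDiff_postcomp {E F : Type u} [NormedAddCommGroup E] [NormedSpace ℝ E]
    [NormedAddCommGroup F] [NormedSpace ℝ F] (h : C(E, F)) (hh : ContDiff ℝ ∞ h) :
    ContDiff ℝ ∞ (fun α : C(I, E) => h.comp α) :=
  contDiff_infty.2 fun n => contDiff_postcomp_nat n h (hh.of_le (by exact_mod_cast le_top))

end Nemytskii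

/-! ### Inverse function theorem. -/

section InverseFunction

/-- The inverse function theorem, with smoothness of the local inverse on its whole domain. -/
lemma exists_smooth_local_inverse {E F : Type*} [NormedAddCommGroup E] [NormedSpace ℝ E]
    [CompleteSpace E] [NormedAddCommGroup F] [NormedSpace ℝ F] {f : E → F}
    {U : Set E} (hU : IsOpen U) (hf : ContDiffOn ℝ ∞ f U) {x₀ : E} (hx₀ : x₀ ∈ U)
    (hinv : (fderiv ℝ f x₀).IsInvertible) :
    ∃ e : OpenPartialHomeomorph E F, x₀ ∈ e.source ∧ e.source ⊆ U ∧ (∀ x, e x = f x) ∧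
      (∀ x ∈ e.source, (fderiv ℝ f x).IsInvertible) ∧ ContDiffOn ℝ ∞ e.symm e.target := by
  obtain ⟨f', hf'⟩ := hinv
  have hc : ContDiffAt ℝ ∞ f x₀ := hf.contDiffAt (hU.mem_nhds hx₀)
  have hd : HasFDerivAt f (f' : E →L[ℝ] F) x₀ := by
    rw [hf']; exact (hc.differentiableAt (by simp)).hasFDerivAt
  let e₀ := hc.toOpenPartialHomeomorph f hd (by simp)
  have hcont : ContinuousOn (fderiv ℝ f) U := hf.continuousOn_fderiv_of_isOpen hU (by simp)
  -- Shrinking to the open set where the derivative is invertible makes the inverse smooth on its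
  -- whole domain, not just at the image of `x₀`.
  have hV : IsOpen (U ∩ fderiv ℝ f ⁻¹' {A | A.IsInvertible}) :=
    hcont.isOpen_inter_preimage hU (ContinuousLinearEquiv.isOpen)
  let e := e₀.restrOpen _ hV
  have he : ∀ x, e x = f x := fun x => by
    simp [e, e₀, ContDiffAt.toOpenPartialHomeomorph_coe]
  have hsrc : e.source = e₀.source ∩ (U ∩ fderiv ℝ f ⁻¹' {A | A.IsInvertible}) := by
    simp [e]
  refine ⟨e, ?_, ?_, he, ?_, ?_⟩
  · rw [hsrc]
    exact ⟨hc.mem_toOpenPartialHomeomorph_source hd (by simp), hx₀, ⟨f', hf'⟩⟩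
  · rw [hsrc]; exact fun x hx => hx.2.1
  · rw [hsrc]; exact fun x hx => hx.2.2
  · intro y hy
    have hxs := e.map_target hy
    have hxs' := hxs
    rw [hsrc] at hxs'
    obtain ⟨g', hg'⟩ := hxs'.2.2
    have hfx : ContDiffAt ℝ ∞ f (e.symm y) := hf.contDiffAt (hU.mem_nhds hxs'.2.1)
    have hefun : (e : E → F) = f := funext he
    refine (e.contDiffAt_symm (f₀' := g') hy ?_ ?_).contDiffWithinAt
    · rw [hefun, hg']; exact (hfx.differentiableAt (by simp)).hasFDerivAt
    · rw [hefun]; exact hfx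

end InverseFunction

/-! ### Integration of curves as a bounded operator. -/

section Primitive

variable {E : Type*} [NormedAddCommGroup E] [NormedSpace ℝ E]

omit [NormedSpace ℝ E] in
lemma continuous_extend (α : C(unitInterval, E)) : Continuous (IccExtend zero_le_one α) :=
  α.continuous.Icc_extend'

/-- The primitive vanishing at `0` of a continuous map on the unit interval. -/
noncomputable def primitiveCLM : C(unitInterval, E) →L[ℝ] C(unitInterval, E) :=
  LinearMap.mkContinuous
    { toFun := fun α => (⟨fun t => ∫ s in (0 : ℝ)..t, IccExtend zero_le_one α s,
        (intervalIntegral.continuous_primitive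
          (fun _ _ => (continuous_extend α).intervalIntegrable _ _) 0).comp
          continuous_subtype_val⟩ : C(unitInterval, E))
      map_add' := fun α β => by
        ext t
        exact intervalIntegral.integral_add ((continuous_extend α).intervalIntegrable _ _)
          ((continuous_extend β).intervalIntegrable _ _)
      map_smul' := fun c α => by
        ext t
        exact intervalIntegral.integral_smul c _ } 1
    (fun α => by
      rw [ContinuousMap.norm_le _ (by positivity)]
      intro t
      refine (intervalIntegral.norm_integral_le_of_norm_le_const (C := ‖α‖)
        (fun s _ => α.norm_coe_le_norm _)).trans ?_
      rw [sub_zero, abs_of_nonneg t.2.1, one_mul]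
      exact mul_le_of_le_one_right (norm_nonneg _) t.2.2)

lemma primitiveCLM_apply (α : C(unitInterval, E)) (t : unitInterval) :
    primitiveCLM α t = ∫ s in (0 : ℝ)..t, IccExtend zero_le_one α s := rfl

lemma hasDerivAt_primitive [CompleteSpace E] (α : C(unitInterval, E)) (t : ℝ) :
    HasDerivAt (fun t : ℝ => ∫ s in (0 : ℝ)..t, IccExtend zero_le_one α s)
      (IccExtend zero_le_one α t) t :=
  intervalIntegral.integral_hasDerivAt_right ((continuous_extend α).intervalIntegrable _ _)
    ((continuous_extend α).stronglyMeasurableAtFilter _ _) (continuous_extend α).continuousAt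

/-- A continuous map that is an integral curve of `δ` starting at `0` is the primitive of `δ`. -/
lemma eq_primitiveCLM [CompleteSpace E] {γ : ℝ → E} {β δ : C(unitInterval, E)}
    (hβ : ∀ t : unitInterval, β t = γ t) (h0 : γ 0 = 0)
    (hγ : ∀ t : unitInterval, HasDerivAt γ (δ t) t) : β = primitiveCLM δ := by
  ext t
  rw [primitiveCLM_apply, hβ t]
  have := intervalIntegral.integral_eq_sub_of_hasDerivAt (f := γ)
    (f' := IccExtend zero_le_one δ) (a := 0) (b := t) (fun s hs => by
      rw [uIcc_of_le t.2.1] at hs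
      have hs' : s ∈ unitInterval := ⟨hs.1, hs.2.trans t.2.2⟩
      rw [IccExtend_of_mem zero_le_one δ hs']
      exact hγ ⟨s, hs'⟩) ((continuous_extend δ).intervalIntegrable _ _)
  rw [this, h0, sub_zero]

end Primitive

/-! ### Joint flow of commuting fields. -/

section Flow

universe u

variable {A E : Type u} [NormedAddCommGroup A] [NormedSpace ℝ A]
  [NormedAddCommGroup E] [NormedSpace ℝ E]

/-- The inclusion of constants in `A` and curves in `E` into curves in `A × E`. -/
noncomputable def constProdCLM : A × C(unitInterval, E) →L[ℝ] C(unitInterval, A × E) :=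
  ((ContinuousLinearMap.inl ℝ A E).compLeftContinuous ℝ unitInterval ∘L
      ContinuousLinearMap.const ℝ unitInterval) ∘L ContinuousLinearMap.fst ℝ _ _ +
    (ContinuousLinearMap.inr ℝ A E).compLeftContinuous ℝ unitInterval ∘L
      ContinuousLinearMap.snd ℝ _ _

@[simp] lemma constProdCLM_apply (p : A × C(unitInterval, E)) (t : unitInterval) :
    constProdCLM p t = (p.1, p.2 t) := by
  simp [constProdCLM]

/-- The defect of a curve `α` from being the integral curve starting at `y` of the field
`h (a, ·)`, as a function of `((a, y), α)`. The pair `(a, y)` is kept as the first component. -/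
noncomputable def flowDefect (h : C(A × E, E)) (p : (A × E) × C(unitInterval, E)) :
    (A × E) × C(unitInterval, E) :=
  (p.1, p.2 - ContinuousLinearMap.const ℝ unitInterval p.1.2 -
    primitiveCLM (h.comp (constProdCLM (p.1.1, p.2))))

/-- The derivative of `flowDefect`. -/
noncomputable def flowDefectDeriv (h' : C(A × E, A × E →L[ℝ] E))
    (p : (A × E) × C(unitInterval, E)) :
    (A × E) × C(unitInterval, E) →L[ℝ] (A × E) × C(unitInterval, E) :=
  let fst := ContinuousLinearMap.fst ℝ (A × E) C(unitInterval, E)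
  let snd := ContinuousLinearMap.snd ℝ (A × E) C(unitInterval, E)
  fst.prod (snd - ContinuousLinearMap.const ℝ unitInterval ∘L
      ContinuousLinearMap.snd ℝ A E ∘L fst -
    primitiveCLM ∘L pointwiseCLM (h'.comp (constProdCLM (p.1.1, p.2))) ∘L constProdCLM ∘L
      (ContinuousLinearMap.fst ℝ A E ∘L fst).prod snd)

lemma flowDefectDeriv_apply (h' : C(A × E, A × E →L[ℝ] E))
    (p q : (A × E) × C(unitInterval, E)) :
    flowDefectDeriv h' p q = (q.1, q.2 - ContinuousLinearMap.const ℝ unitInterval q.1.2 -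
      primitiveCLM (pointwiseCLM (h'.comp (constProdCLM (p.1.1, p.2)))
        (constProdCLM (q.1.1, q.2)))) := rfl

lemma contDiff_flowDefect (h : C(A × E, E)) (hh : ContDiff ℝ ∞ h) :
    ContDiff ℝ ∞ (flowDefect h) := by
  have h1 : ContDiff ℝ ∞ fun p : (A × E) × C(unitInterval, E) =>
      h.comp (constProdCLM (p.1.1, p.2)) :=
    (contDiff_postcomp h hh).comp
      ((constProdCLM (A := A) (E := E)).contDiff.comp (by fun_prop))
  have h2 : ContDiff ℝ ∞ fun p : (A × E) × C(unitInterval, E) =>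
      ContinuousLinearMap.const ℝ unitInterval p.1.2 :=
    (ContinuousLinearMap.const (M := E) ℝ unitInterval).contDiff.comp (by fun_prop)
  have h3 : ContDiff ℝ ∞ fun p : (A × E) × C(unitInterval, E) =>
      primitiveCLM (h.comp (constProdCLM (p.1.1, p.2))) :=
    (primitiveCLM (E := E)).contDiff.comp h1
  exact contDiff_fst.prodMk ((contDiff_snd.sub h2).sub h3)

lemma hasFDerivAt_flowDefect (h : C(A × E, E)) (h' : C(A × E, A × E →L[ℝ] E))
    (hh : ∀ x, HasFDerivAt h (h' x) x) (p : (A × E) × C(unitInterval, E)) :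
    HasFDerivAt (flowDefect h) (flowDefectDeriv h' p) p := by
  let fst := ContinuousLinearMap.fst ℝ (A × E) C(unitInterval, E)
  let snd := ContinuousLinearMap.snd ℝ (A × E) C(unitInterval, E)
  have h0 := (constProdCLM (A := A) (E := E) ∘L
    (ContinuousLinearMap.fst ℝ A E ∘L fst).prod snd).hasFDerivAt (x := p)
  have h1 := (hasFDerivAt_postcomp h h' hh (constProdCLM (p.1.1, p.2))).comp p h0
  have h2 := (primitiveCLM (E := E)).hasFDerivAt.comp p h1
  have h3 := (ContinuousLinearMap.const (M := E) ℝ unitInterval ∘L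
      ContinuousLinearMap.snd ℝ A E ∘L fst).hasFDerivAt (x := p)
  exact fst.hasFDerivAt.prodMk ((snd.hasFDerivAt.sub h3).sub h2)

/-- Commuting smooth fields `X · a`, depending linearly on `a`, have a joint flow `Φ (a, y)` that
moves with velocity `X · b` when `a` moves with velocity `b`. -/
theorem exists_commuting_flow [CompleteSpace A] [CompleteSpace E] {X : E → A →L[ℝ] E}
    (hX : ContDiff ℝ ∞ X) (x₀ : E)
    (hcomm : ∀ᶠ x in 𝓝 x₀, ∀ a b, fderiv ℝ X x (X x a) b = fderiv ℝ X x (X x b) a) :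
    ∃ (Φ : A × E → E) (U : Set (A × E)), IsOpen U ∧ (0, x₀) ∈ U ∧ ContDiffOn ℝ ∞ Φ U ∧
      (∀ y, (0, y) ∈ U → Φ (0, y) = y) ∧
      ∀ p ∈ U, ∀ b, fderiv ℝ Φ p (b, 0) = X (Φ p) b := by
  have hsm : ContDiff ℝ ∞ fun p : A × E => X p.2 p.1 := by fun_prop
  let h : C(A × E, E) := ⟨fun p => X p.2 p.1, hsm.continuous⟩
  have hh : ContDiff ℝ ∞ h := hsm
  have hderiv : ContDiff ℝ ∞ (fderiv ℝ h) := hh.fderiv_right (by simp)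
  let h' : C(A × E, A × E →L[ℝ] E) := ⟨fderiv ℝ h, hderiv.continuous⟩
  have hh' : ∀ x, HasFDerivAt h (h' x) x := fun x =>
    (hh.differentiable (by simp) x).hasFDerivAt
  have hXd : ∀ x, HasFDerivAt X (fderiv ℝ X x) x := fun x =>
    (hX.differentiable (by simp) x).hasFDerivAt
  have hh'apply : ∀ (a b : A) (x v : E), h' (a, x) (b, v) = X x b + fderiv ℝ X x v a := by
    intro a b x v
    have h1 : HasFDerivAt (fun p : A × E => X p.2)
        (fderiv ℝ X x ∘L ContinuousLinearMap.snd ℝ A E) (a, x) :=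
      (hXd x).comp (a, x) (ContinuousLinearMap.snd ℝ A E).hasFDerivAt
    have h2 := h1.clm_apply (ContinuousLinearMap.fst ℝ A E).hasFDerivAt
    rw [(hh' (a, x)).unique h2]
    simp
  obtain ⟨N, hN, hNo, hxN⟩ := eventually_nhds_iff.1 hcomm
  -- Curves are confined to `N`, so that the commutation relation is available along the whole of
  -- each solution curve.
  let D : Set ((A × E) × C(unitInterval, E)) :=
    Prod.snd ⁻¹' {α | MapsTo α univ N}
  have hD : IsOpen D :=
    (ContinuousMap.isOpen_setOfPred_mapsTo isCompact_univ hNo).preimage continuous_snd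
  let q₀ : (A × E) × C(unitInterval, E) :=
    ((0, x₀), ContinuousLinearMap.const ℝ unitInterval x₀)
  have hG₀ : flowDefect h q₀ = ((0, x₀), 0) := by
    have : h.comp (constProdCLM (q₀.1.1, q₀.2)) = 0 := by
      ext t; simp [h, q₀]
    simp only [flowDefect, this, map_zero]
    simp [q₀]
  -- At `a = 0` the field vanishes identically in `x`, so the integral term contributes nothing in
  -- the curve direction: the derivative is triangular with identity diagonal.
  have hinv : (fderiv ℝ (flowDefect h) q₀).IsInvertible := by
    rw [(hasFDerivAt_flowDefect h h' hh' q₀).fderiv]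
    let S : A × E →L[ℝ] C(unitInterval, E) :=
      ContinuousLinearMap.const ℝ unitInterval ∘L ContinuousLinearMap.snd ℝ A E +
      primitiveCLM ∘L ContinuousLinearMap.const ℝ unitInterval ∘L X x₀ ∘L
        ContinuousLinearMap.fst ℝ A E
    refine ⟨(ContinuousLinearEquiv.refl ℝ (A × E)).skewProd
      (ContinuousLinearEquiv.refl ℝ C(unitInterval, E)) (-S), ?_⟩
    refine ContinuousLinearMap.ext fun q => ?_
    have : pointwiseCLM (h'.comp (constProdCLM (q₀.1.1, q₀.2))) (constProdCLM (q.1.1, q.2)) =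
        ContinuousLinearMap.const ℝ unitInterval (X x₀ q.1.1) := by
      ext t; simp [q₀, hh'apply]
    rw [flowDefectDeriv_apply, this]
    simp only [S, ContinuousLinearEquiv.coe_coe, ContinuousLinearEquiv.skewProd_apply,
      ContinuousLinearEquiv.refl_apply]
    refine Prod.ext rfl ?_
    simp only [sub_eq_add_neg, neg_add, neg_apply, add_apply]
    exact (add_assoc _ _ _).symm
  obtain ⟨e, hqe, heD, he, heinv, hesm⟩ := exists_smooth_local_inverse hD
    (contDiff_flowDefect h hh).contDiffOn (x₀ := q₀)
    (show MapsTo _ _ _ from fun _ _ => hxN) hinv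
  let j : A × E → (A × E) × C(unitInterval, E) := fun p => (p, 0)
  let U : Set (A × E) := j ⁻¹' e.target
  have hj : ContDiff ℝ ∞ j := contDiff_id.prodMk contDiff_const
  have hU : IsOpen U := e.open_target.preimage hj.continuous
  let α : A × E → C(unitInterval, E) := fun p => (e.symm (j p)).2
  have hα : ContDiffOn ℝ ∞ α U :=
    contDiff_snd.comp_contDiffOn (hesm.comp hj.contDiffOn fun _ hp => hp)
  have hGα : ∀ p ∈ U, flowDefect h (p, α p) = (p, 0) ∧ (p, α p) ∈ e.source := by
    intro p hp
    have h1 : flowDefect h (e.symm (j p)) = j p := by rw [← he]; exact e.right_inv hp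
    have h2 : (e.symm (j p)).1 = p := congrArg Prod.fst h1
    have h3 : e.symm (j p) = (p, α p) := Prod.ext h2 rfl
    rw [← h3]
    exact ⟨h1, e.map_target hp⟩
  have hcurve : ∀ p ∈ U, α p = ContinuousLinearMap.const ℝ unitInterval p.2 +
      primitiveCLM (h.comp (constProdCLM (p.1, α p))) := by
    intro p hp
    have h1 := congrArg Prod.snd (hGα p hp).1
    simp only [flowDefect] at h1
    rw [sub_sub, sub_eq_zero] at h1
    exact h1
  let ev : C(unitInterval, E) →L[ℝ] E := ContinuousMap.evalCLM ℝ 1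
  refine ⟨fun p => α p 1, U, hU, ?_, ev.contDiff.comp_contDiffOn hα, ?_, ?_⟩
  · change ((0, x₀), 0) ∈ e.target
    rw [← hG₀, ← he]
    exact e.map_source hqe
  · intro y hy
    have h1 : h.comp (constProdCLM (0, α (0, y))) = 0 := by
      ext t; simp [h]
    have h2 := hcurve _ hy
    simp only [h1, map_zero, add_zero] at h2
    simp only [h2]
    rfl
  · intro p hp b
    have hαd : HasFDerivAt α (fderiv ℝ α p) p :=
      ((hα.contDiffAt (hU.mem_nhds hp)).differentiableAt (by simp)).hasFDerivAt
    have hΦd : HasFDerivAt (fun p => α p 1) (ev ∘L fderiv ℝ α p) p :=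
      ev.hasFDerivAt.comp p hαd
    obtain ⟨hGp, hsrc⟩ := hGα p hp
    have hGd : fderiv ℝ (flowDefect h) (p, α p) = flowDefectDeriv h' (p, α p) :=
      (hasFDerivAt_flowDefect h h' hh' _).fderiv
    -- Differentiate the identity `flowDefect h (p, α p) = (p, 0)` in the direction `(b, 0)`.
    have hlin : flowDefectDeriv h' (p, α p) ((b, 0), fderiv ℝ α p (b, 0)) = ((b, 0), 0) := by
      have h1 : HasFDerivAt (fun p => flowDefect h (p, α p)) _ p :=
        (hasFDerivAt_flowDefect h h' hh' (p, α p)).comp (f := fun p => (p, α p)) p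
          ((hasFDerivAt_id p).prodMk hαd)
      have h2 : HasFDerivAt j ((ContinuousLinearMap.id ℝ (A × E)).prod 0) p :=
        (hasFDerivAt_id p).prodMk (hasFDerivAt_const _ _)
      have h3 : (fun p => flowDefect h (p, α p)) =ᶠ[𝓝 p] j := by
        filter_upwards [hU.mem_nhds hp] with p' hp' using (hGα p' hp').1
      have h4 := congrArg (fun T => T (b, 0)) (h1.unique (h2.congr_of_eventuallyEq h3))
      simpa using h4
    -- The expected variation of the curve: for commuting fields, changing `a` by `b` moves the
    -- point at time `t` along `X · b` for time `t`. In checking the linearized equation, `d/dt`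
    -- produces `t • DX (X a) b` where `t • DX (X b) a` is required; commutation identifies the two.
    let β : C(unitInterval, E) := ⟨fun t => (t : ℝ) • X (α p t) b, by
      have := hX.continuous
      fun_prop⟩
    have hβ : β = primitiveCLM (pointwiseCLM (h'.comp (constProdCLM (p.1, α p)))
        (constProdCLM (b, β))) := by
      let c : ℝ → E := fun t => p.2 +
        ∫ s in (0 : ℝ)..t, IccExtend zero_le_one (h.comp (constProdCLM (p.1, α p))) s
      have hc : ∀ t : unitInterval, α p t = c t := fun t =>
        congrArg (fun f : C(unitInterval, E) => f t) (hcurve p hp)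
      refine eq_primitiveCLM (γ := fun t => t • X (c t) b) (fun t => ?_) (by simp) fun t => ?_
      · simp [β, hc]
      · have h1 : HasDerivAt c (X (α p t) p.1) t := by
          have := (hasDerivAt_primitive (h.comp (constProdCLM (p.1, α p))) t).const_add p.2
          rw [IccExtend_of_mem zero_le_one _ t.2] at this
          convert this using 1
          simp [h]
        have h2 : HasDerivAt (fun t => X (c t)) (fderiv ℝ X (α p t) (X (α p t) p.1)) t := by
          rw [hc t] at h1 ⊢
          exact (hXd (c t)).comp_hasDerivAt (t : ℝ) h1
        have h3 := (hasDerivAt_id (t : ℝ)).smul (h2.clm_apply (hasDerivAt_const (t : ℝ) b))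
        have h4 : α p t ∈ N := heD hsrc (mem_univ t)
        convert h3 using 1
        · rfl
        · have h5 : β t = (t : ℝ) • X (α p t) b := rfl
          rw [pointwiseCLM_apply, ContinuousMap.comp_apply, constProdCLM_apply,
            constProdCLM_apply, hh'apply, h5, hN _ h4 p.1 b, ← hc]
          simp [add_comm]
    have hlinβ : flowDefectDeriv h' (p, α p) ((b, 0), β) = ((b, 0), 0) := by
      rw [flowDefectDeriv_apply]
      simp [← hβ]
    -- Invertibility of the linearization gives uniqueness for the linearized equation, so `β` is
    -- the actual derivative.
    have hinj : Function.Injective (flowDefectDeriv h' (p, α p)) := by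
      obtain ⟨g, hg⟩ := heinv _ hsrc
      rw [← hGd, ← hg]
      exact g.injective
    have h5 : fderiv ℝ α p (b, 0) = β :=
      congrArg Prod.snd (hinj (hlin.trans hlinβ.symm))
    rw [hΦd.fderiv, ContinuousLinearMap.comp_apply, h5]
    simp [ev, β]

end Flow

/-! ### Straightening commuting fields. -/

section FirstIntegral

universe u

variable {A E : Type u} [NormedAddCommGroup A] [NormedSpace ℝ A] [FiniteDimensional ℝ A]
  [NormedAddCommGroup E] [NormedSpace ℝ E] [FiniteDimensional ℝ E]

omit [FiniteDimensional ℝ A] in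
/-- A smooth map on a neighbourhood of a point agrees near this point with a globally smooth map. -/
lemma exists_contDiff_eqOn_ball {X : E → A} {U : Set E} (hU : IsOpen U)
    (hX : ContDiffOn ℝ ∞ X U) {x₀ : E} (hx₀ : x₀ ∈ U) :
    ∃ (X' : E → A) (r : ℝ), 0 < r ∧ ContDiff ℝ ∞ X' ∧ Metric.ball x₀ r ⊆ U ∧
      EqOn X' X (Metric.ball x₀ r) := by
  obtain ⟨R, hR, hRU⟩ := Metric.isOpen_iff.1 hU x₀ hx₀
  let χ : ContDiffBump x₀ := ⟨R / 4, R / 2, by positivity, by linarith⟩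
  refine ⟨fun x => χ x • X x, R / 4, by positivity, ?_,
    (Metric.ball_subset_ball (by linarith)).trans hRU, fun x hx => ?_⟩
  · rw [contDiff_iff_contDiffAt]
    intro x
    by_cases hx : x ∈ tsupport χ
    · rw [χ.tsupport_eq] at hx
      have hxU : x ∈ U := hRU (Metric.closedBall_subset_ball (by simp [χ]; linarith) hx)
      exact χ.contDiff.contDiffAt.smul (hX.contDiffAt (hU.mem_nhds hxU))
    · have : (fun x => χ x • X x) =ᶠ[𝓝 x] fun _ => 0 := by
        filter_upwards [notMem_tsupport_iff_eventuallyEq.1 hx] with y hy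
        simp [hy]
      exact contDiffAt_const.congr_of_eventuallyEq this
  · have : χ x = 1 := χ.one_of_mem_closedBall (Metric.ball_subset_closedBall hx)
    simp [this]

/-- Commuting pointwise independent fields `X · a`, depending linearly on `a`, admit locally a
smooth function with prescribed constant derivatives along them. -/
theorem exists_first_integral {X : E → A →L[ℝ] E} {U : Set E} (hU : IsOpen U)
    (hX : ContDiffOn ℝ ∞ X U) {x₀ : E} (hx₀ : x₀ ∈ U) (hinj : Function.Injective (X x₀))
    (hcomm : ∀ x ∈ U, ∀ a b, fderiv ℝ X x (X x a) b = fderiv ℝ X x (X x b) a)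
    (l : A →L[ℝ] ℝ) :
    ∃ (V : Set E) (f : E → ℝ), IsOpen V ∧ x₀ ∈ V ∧ V ⊆ U ∧ ContDiffOn ℝ ∞ f V ∧
      ∀ x ∈ V, ∀ a, fderiv ℝ f x (X x a) = l a := by
  have : CompleteSpace A := FiniteDimensional.complete ℝ A
  have : CompleteSpace E := FiniteDimensional.complete ℝ E
  -- The flow theorem takes a globally smooth family but needs commutation only near `x₀`, so a
  -- cut-off is harmless.
  obtain ⟨X', r, hr, hX', hrU, hEq⟩ := exists_contDiff_eqOn_ball hU hX hx₀
  have hcomm' : ∀ᶠ x in 𝓝 x₀, ∀ a b, fderiv ℝ X' x (X' x a) b = fderiv ℝ X' x (X' x b) a := by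
    filter_upwards [Metric.ball_mem_nhds x₀ hr] with x hx a b
    have h1 : X' =ᶠ[𝓝 x] X := hEq.eventuallyEq_of_mem (Metric.isOpen_ball.mem_nhds hx)
    rw [h1.fderiv_eq, hEq hx]
    exact hcomm x (hrU hx) a b
  obtain ⟨Φ, O, hO, h0O, hΦ, hΦ0, hΦd⟩ := exists_commuting_flow hX' x₀ hcomm'
  obtain ⟨S, hS⟩ := Submodule.exists_isCompl (LinearMap.range (X x₀ : A →ₗ[ℝ] E))
  -- Flowing for time `a` from the transversal `x₀ + S` gives coordinates in which each field `X ·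
  -- b` is the constant field `(b, 0)`; the function sought is `l` of the `A`-coordinate.
  let j : A × S → A × E := fun q => (q.1, x₀ + q.2)
  have hj : ContDiff ℝ ∞ j :=
    contDiff_fst.prodMk (contDiff_const.add (S.subtypeL.contDiff.comp contDiff_snd))
  have hjd : ∀ q, HasFDerivAt j ((ContinuousLinearMap.fst ℝ A S).prod
      (S.subtypeL ∘L ContinuousLinearMap.snd ℝ A S)) q := fun q =>
    (ContinuousLinearMap.fst ℝ A S).hasFDerivAt.prodMk
      ((S.subtypeL ∘L ContinuousLinearMap.snd ℝ A S).hasFDerivAt.const_add x₀)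
  have hΨ : ContDiffOn ℝ ∞ (Φ ∘ j) (j ⁻¹' O) := hΦ.comp hj.contDiffOn fun _ h => h
  have hΦdiff : ∀ p ∈ O, HasFDerivAt Φ (fderiv ℝ Φ p) p := fun p hp =>
    ((hΦ.contDiffAt (hO.mem_nhds hp)).differentiableAt (by simp)).hasFDerivAt
  have hΨd : ∀ q, j q ∈ O → HasFDerivAt (Φ ∘ j) (fderiv ℝ Φ (j q) ∘L
      (ContinuousLinearMap.fst ℝ A S).prod (S.subtypeL ∘L ContinuousLinearMap.snd ℝ A S)) q :=
    fun q hq => (hΦdiff _ hq).comp q (hjd q)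
  have hj0 : j 0 = (0, x₀) := by simp [j]
  have hvert : ∀ v, fderiv ℝ Φ (0, x₀) (0, v) = v := by
    intro v
    have h1 : HasFDerivAt (fun y : E => ((0 : A), y)) (ContinuousLinearMap.inr ℝ A E) x₀ :=
      (ContinuousLinearMap.inr ℝ A E).hasFDerivAt
    have h2 := (hΦdiff _ h0O).comp x₀ h1
    have h3 : Φ ∘ (fun y : E => ((0 : A), y)) =ᶠ[𝓝 x₀] id := by
      filter_upwards [h1.continuousAt.preimage_mem_nhds (hO.mem_nhds h0O)] with y hy
      exact hΦ0 y hy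
    have h4 := h2.unique ((hasFDerivAt_id x₀).congr_of_eventuallyEq h3)
    simpa using congrArg (fun T => T v) h4
  have hΨ0 : ∀ q : A × S, fderiv ℝ (Φ ∘ j) 0 q = X x₀ q.1 + q.2 := by
    intro q
    have hx : x₀ ∈ Metric.ball x₀ r := Metric.mem_ball_self hr
    have h0 : Φ (0, x₀) = x₀ := hΦ0 _ h0O
    have h1 := hΦd _ h0O q.1
    rw [h0, hEq hx] at h1
    rw [(hΨd 0 (by rwa [hj0])).fderiv, hj0, ← h1]
    conv_rhs => rw [← hvert (q.2 : E)]
    rw [← map_add]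
    simp
  have hbij : Function.Bijective (fderiv ℝ (Φ ∘ j) 0) := by
    constructor
    · rw [injective_iff_map_eq_zero]
      rintro ⟨a, s⟩ h
      rw [hΨ0] at h
      have h1 : X x₀ a ∈ LinearMap.range (X x₀ : A →ₗ[ℝ] E) := ⟨a, rfl⟩
      have h2 : X x₀ a ∈ S := by
        rw [eq_neg_of_add_eq_zero_left h]
        exact S.neg_mem s.2
      have h3 : X x₀ a = 0 := by
        simpa using hS.disjoint.le_bot (Submodule.mem_inf.2 ⟨h1, h2⟩)
      have h4 : a = 0 := hinj (h3.trans (map_zero _).symm)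
      have h5 : s = 0 := by
        rw [h3, zero_add] at h
        exact Subtype.ext h
      rw [h4, h5]; rfl
    · intro v
      have : v ∈ LinearMap.range (X x₀ : A →ₗ[ℝ] E) ⊔ S := by rw [hS.sup_eq_top]; trivial
      obtain ⟨_, ⟨a, rfl⟩, s, hs, rfl⟩ := Submodule.mem_sup.1 this
      exact ⟨(a, ⟨s, hs⟩), hΨ0 _⟩
  have hinv : (fderiv ℝ (Φ ∘ j) 0).IsInvertible :=
    ⟨(LinearEquiv.ofBijective (fderiv ℝ (Φ ∘ j) 0 : A × S →ₗ[ℝ] E) hbij).toContinuousLinearEquiv,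
      by ext <;> rfl⟩
  obtain ⟨e, he0, heO, he, -, hesm⟩ := exists_smooth_local_inverse
    (hO.preimage hj.continuous) hΨ (x₀ := 0) (by rw [mem_preimage, hj0]; exact h0O) hinv
  refine ⟨e.target ∩ Metric.ball x₀ r, fun x => l (e.symm x).1,
    e.open_target.inter Metric.isOpen_ball, ⟨?_, Metric.mem_ball_self hr⟩,
    inter_subset_right.trans hrU, ?_, ?_⟩
  · have h1 : e 0 = x₀ := by rw [he, Function.comp_apply, hj0, hΦ0 _ h0O]
    rw [← h1]
    exact e.map_source he0
  · exact (l.contDiff.comp contDiff_fst).comp_contDiffOn (hesm.mono inter_subset_left)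
  · rintro x ⟨hxt, hxr⟩ b
    have hq : e.symm x ∈ e.source := e.map_target hxt
    have hx : Φ (j (e.symm x)) = x := by
      have := e.right_inv hxt
      rwa [he] at this
    have hfd : HasFDerivAt (fun x => l (e.symm x).1)
        (fderiv ℝ (fun x => l (e.symm x).1) x) ((Φ ∘ j) (e.symm x)) := by
      rw [Function.comp_apply, hx]
      exact (((l.contDiff.comp contDiff_fst).comp_contDiffOn hesm).contDiffAt
        (e.open_target.mem_nhds hxt) |>.differentiableAt (by simp)).hasFDerivAt
    have h1 := hfd.comp (e.symm x) (hΨd _ (heO hq))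
    have h2 : (fun x => l (e.symm x).1) ∘ (Φ ∘ j) =ᶠ[𝓝 (e.symm x)]
        (l ∘L ContinuousLinearMap.fst ℝ A S) := by
      filter_upwards [e.open_source.mem_nhds hq] with q hq
      have h3 : (Φ ∘ j) q = e q := (he q).symm
      simp only [Function.comp_apply] at h3 ⊢
      rw [h3, e.left_inv hq]
      rfl
    have h3 := congrArg (fun T => T (b, 0))
      (h1.unique ((l ∘L ContinuousLinearMap.fst ℝ A S).hasFDerivAt.congr_of_eventuallyEq h2))
    have h4 := hΦd _ (heO hq) b
    rw [hx, hEq hxr] at h4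
    simpa [h4] using h3

end FirstIntegral

/-! ### Linear algebra of the class. -/

section LinearAlgebra

variable {T : Type*} [AddCommGroup T] [Module ℝ T] [TopologicalSpace T]
  [IsTopologicalAddGroup T] [ContinuousSMul ℝ T]

omit [IsTopologicalAddGroup T] [ContinuousSMul ℝ T] in
lemma alternating_swap {B : T →L[ℝ] T →L[ℝ] ℝ} (hB : ∀ v, B v v = 0) (v w : T) :
    B v w = -B w v := by
  have h := hB (v + w)
  simp only [map_add, add_apply, hB, zero_add, add_zero] at h
  linarith

omit [IsTopologicalAddGroup T] [ContinuousSMul ℝ T] in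
/-- An element of a complement of the kernel of an alternating form that pairs trivially with
this complement is zero. -/
lemma eq_zero_of_mem_compl_kernel {B : T →L[ℝ] T →L[ℝ] ℝ} (hB : ∀ v, B v v = 0)
    {W : Submodule ℝ T} (hW : IsCompl (kernel B) W) {v : T} (hv : v ∈ W)
    (h : ∀ w ∈ W, B v w = 0) : v = 0 := by
  have hk : v ∈ kernel B := by
    intro w
    have : w ∈ kernel B ⊔ W := by rw [hW.sup_eq_top]; trivial
    obtain ⟨k, hk, w, hw, rfl⟩ := Submodule.mem_sup.1 this
    rw [map_add, h w hw, alternating_swap hB, hk v]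
    simp
  simpa using hW.disjoint.le_bot (Submodule.mem_inf.2 ⟨hk, hv⟩)

omit [IsTopologicalAddGroup T] [ContinuousSMul ℝ T] in
/-- The rank of an alternating form is even. -/
lemma even_finrank_quotient_kernel [FiniteDimensional ℝ T] {B : T →L[ℝ] T →L[ℝ] ℝ}
    (hB : ∀ v, B v v = 0) : Even (finrank ℝ (T ⧸ kernel B)) := by
  obtain ⟨W, hW⟩ := Submodule.exists_isCompl (kernel B)
  rw [(Submodule.quotientEquivOfIsCompl _ W hW).finrank_eq]
  let b := finBasis ℝ W
  -- In odd size this antisymmetric matrix is singular; a null vector would be a nonzero element of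
  -- `W` pairing trivially with `W`.
  let A : Matrix (Fin (finrank ℝ W)) (Fin (finrank ℝ W)) ℝ := fun i j => B (b j) (b i)
  have hA : A.transpose = -A := by
    ext i j
    exact alternating_swap hB _ _
  by_contra hodd
  rw [Nat.not_even_iff_odd] at hodd
  have hdet : A.det = 0 := by
    have h1 : A.det = (-A).det := by rw [← hA, Matrix.det_transpose]
    rw [Matrix.det_neg, Fintype.card_fin, hodd.neg_one_pow] at h1
    linarith
  obtain ⟨v, hv, hAv⟩ := Matrix.exists_mulVec_eq_zero_iff.2 hdet
  have hBv : ∀ i, B (b.equivFun.symm v : W) (b i) = 0 := by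
    intro i
    have h1 := congrFun hAv i
    rw [Basis.equivFun_symm_apply]
    simp only [Matrix.mulVec, dotProduct, A, Pi.zero_apply] at h1
    simp only [Submodule.coe_sum, map_sum, Submodule.coe_smul, map_smul, sum_apply, smul_apply,
      smul_eq_mul]
    rw [← h1]
    exact Finset.sum_congr rfl fun _ _ => mul_comm _ _
  set x : W := b.equivFun.symm v with hx
  clear_value x
  have h0 := eq_zero_of_mem_compl_kernel hB hW x.2 fun w hw => by
    have h2 : (⟨w, hw⟩ : W) = ∑ i, b.repr ⟨w, hw⟩ i • b i := (b.sum_repr _).symm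
    have h3 : w = ((∑ i, b.repr ⟨w, hw⟩ i • b i : W) : T) := congrArg Subtype.val h2
    rw [h3]
    simp only [Submodule.coe_sum, map_sum, Submodule.coe_smul, map_smul, hBv, smul_zero,
      Finset.sum_const_zero]
  have h4 : b.equivFun.symm v = 0 := hx ▸ Subtype.ext h0
  exact hv (b.equivFun.symm.injective (h4.trans (map_zero _).symm))

omit [IsTopologicalAddGroup T] [ContinuousSMul ℝ T] in
/-- If `(a, B)` has even class, then `a` vanishes on the kernel of `B`. -/
lemma kernel_le_kernelCovector [FiniteDimensional ℝ T] {a : T →L[ℝ] ℝ}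
    {B : T →L[ℝ] T →L[ℝ] ℝ} (hB : ∀ v, B v v = 0) (h : Even (pairClass a B)) :
    kernel B ≤ kernelCovector a := by
  by_contra hle
  obtain ⟨u, hu, hau⟩ := SetLike.not_le_iff_exists.1 hle
  have hau' : a u ≠ 0 := hau
  -- Since `a u ≠ 0`, the common kernel is a hyperplane of `kernel B`, which makes the class the
  -- even rank of `B` plus one.
  have hsup : (kernelCovector a ⊓ kernel B) ⊔ Submodule.span ℝ {u} = kernel B := by
    apply le_antisymm
    · exact sup_le inf_le_right ((Submodule.span_singleton_le_iff_mem _ _).2 hu)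
    · intro v hv
      refine Submodule.mem_sup.2 ⟨v - (a v / a u) • u, ⟨?_, ?_⟩, (a v / a u) • u,
        Submodule.smul_mem _ _ (Submodule.mem_span_singleton_self u), by abel⟩
      · change a _ = 0
        simp [hau']
      · exact (kernel B).sub_mem hv ((kernel B).smul_mem _ hu)
  have hinf : (kernelCovector a ⊓ kernel B) ⊓ Submodule.span ℝ {u} = ⊥ := by
    rw [eq_bot_iff]
    rintro v ⟨⟨hv, -⟩, hvu⟩
    obtain ⟨c, rfl⟩ := Submodule.mem_span_singleton.1 hvu
    have h1 : a (c • u) = 0 := hv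
    have h2 : c = 0 := by simpa [hau'] using h1
    simp [h2]
  have h1 := Submodule.finrank_sup_add_finrank_inf_eq (kernelCovector a ⊓ kernel B)
    (Submodule.span ℝ {u})
  have hu0 : u ≠ 0 := by rintro rfl; simp at hau'
  rw [hsup, hinf, finrank_bot, finrank_span_singleton hu0] at h1
  have h2 := Submodule.finrank_quotient_add_finrank (kernelCovector a ⊓ kernel B)
  have h3 := Submodule.finrank_quotient_add_finrank (kernel B)
  have h4 := even_finrank_quotient_kernel hB
  rw [pairClass] at h
  have h5 : finrank ℝ (T ⧸ kernelCovector a ⊓ kernel B) = finrank ℝ (T ⧸ kernel B) + 1 := by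
    omega
  rw [h5] at h
  exact absurd h4 (Nat.even_add_one.1 h)

omit [IsTopologicalAddGroup T] [ContinuousSMul ℝ T] in
/-- If `a = ι_D B` and `f` has differential `-1` along `D` and `0` along the kernel of `B`, then
rescaling by `g = exp f` lowers the class by one; here `dg` is the differential of `g`. -/
lemma pairClass_rescale [FiniteDimensional ℝ T] {a : T →L[ℝ] ℝ} {B : T →L[ℝ] T →L[ℝ] ℝ}
    (hB : ∀ v, B v v = 0) (ha : a ≠ 0) {D : T} (hD : ∀ w, B D w = a w) {n : ℕ}
    (hn : pairClass a B = n + 1) {g : ℝ} (hg : g ≠ 0) {dg : T →L[ℝ] ℝ}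
    (hdg : ∀ v ∈ kernel B, dg v = 0) (hdgD : dg D = -g) :
    pairClass (g • a) (wedge dg a + g • B) = n := by
  have hka : kernel B ≤ kernelCovector a := by
    intro v hv
    change a v = 0
    rw [← hD, alternating_swap hB, hv, neg_zero]
  have hDk : D ∉ kernel B := fun h => ha (by ext w; rw [← hD, h w]; rfl)
  have hD0 : D ≠ 0 := by rintro rfl; exact hDk (kernel B).zero_mem
  have hker : kernelCovector (g • a) ⊓ kernel (wedge dg a + g • B) =
      kernel B ⊔ Submodule.span ℝ {D} := by
    ext v
    have hw : ∀ w, (wedge dg a + g • B) v w = dg v * a w - a v * dg w + g * B v w := by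
      intro w; simp [wedge]
    constructor
    · rintro ⟨h1, h2⟩
      have h1' : a v = 0 := by
        have : g * a v = 0 := h1
        exact (mul_eq_zero.1 this).resolve_left hg
      -- Once `a v = 0`, the condition on `v` is `dg v * a w + g * B v w = 0`; as `a = B D`, it says
      -- that `v + (dg v / g) • D` lies in `kernel B`.
      refine Submodule.mem_sup.2 ⟨v + (dg v / g) • D, fun w => ?_, -(dg v / g) • D,
        Submodule.smul_mem _ _ (Submodule.mem_span_singleton_self D), by simp⟩
      have h3 := h2 w
      rw [hw, h1'] at h3
      simp only [map_add, map_smul, add_apply, smul_apply, smul_eq_mul, hD]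
      field_simp
      linarith
    · intro hv
      obtain ⟨k, hk, u, hu, rfl⟩ := Submodule.mem_sup.1 hv
      obtain ⟨t, rfl⟩ := Submodule.mem_span_singleton.1 hu
      have hak : a k = 0 := hka hk
      have haD : a D = 0 := by rw [← hD, hB]
      have h0 : a (k + t • D) = 0 := by simp [hak, haD]
      refine ⟨?_, fun w => ?_⟩
      · change g * a (k + t • D) = 0
        rw [h0, mul_zero]
      · rw [hw, h0]
        simp only [map_add, map_smul, add_apply, smul_apply, smul_eq_mul, hD, hk w, hdg k hk, hdgD]
        ring
  have hinf : kernel B ⊓ Submodule.span ℝ {D} = ⊥ := by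
    rw [eq_bot_iff]
    rintro v ⟨hv, hvD⟩
    obtain ⟨c, rfl⟩ := Submodule.mem_span_singleton.1 hvD
    by_contra hc
    have hc0 : c ≠ 0 := by rintro rfl; simp at hc
    exact hDk (((kernel B).smul_mem_iff hc0).1 hv)
  have h1 := Submodule.finrank_sup_add_finrank_inf_eq (kernel B) (Submodule.span ℝ {D})
  rw [hinf, finrank_bot, finrank_span_singleton hD0] at h1
  rw [pairClass, inf_eq_right.2 hka] at hn
  rw [pairClass, hker]
  have h2 := Submodule.finrank_quotient_add_finrank (kernel B ⊔ Submodule.span ℝ {D})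
  have h3 := Submodule.finrank_quotient_add_finrank (kernel B)
  omega

end LinearAlgebra

/-! ### Normalized frames, commutation and the potential. -/

section Frame

variable {E : Type} [NormedAddCommGroup E] [NormedSpace ℝ E] [FiniteDimensional ℝ E]

/-- Near a point, a `2`-form of constant rank has a smooth frame `Y` of its kernel and, if the
`1`-form `τ` vanishes on this kernel, a Liouville field `Δ`, both normalized by a projection `P`
onto the kernel at the point. -/
theorem exists_adapted_frame {U : Set E} (hU : IsOpen U) {B : E → E →L[ℝ] E →L[ℝ] ℝ}
    {τ : E → E →L[ℝ] ℝ} (hB : ContDiffOn ℝ ∞ B U) (hτ : ContDiffOn ℝ ∞ τ U)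
    (halt : ∀ z ∈ U, ∀ v, B z v v = 0) (hker : ∀ z ∈ U, kernel (B z) ≤ kernelCovector (τ z))
    {z₀ : E} (hz₀ : z₀ ∈ U)
    (hrank : ∀ z ∈ U, finrank ℝ (kernel (B z)) = finrank ℝ (kernel (B z₀))) :
    ∃ (k : ℕ) (V : Set E) (P : E →L[ℝ] EuclideanSpace ℝ (Fin k))
      (Y : E → EuclideanSpace ℝ (Fin k) →L[ℝ] E) (Δ : E → E),
      IsOpen V ∧ z₀ ∈ V ∧ V ⊆ U ∧ ContDiffOn ℝ ∞ Y V ∧ ContDiffOn ℝ ∞ Δ V ∧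
      (∀ z ∈ V, P (Δ z) = 0) ∧ (∀ z ∈ V, ∀ w, B z (Δ z) w = τ z w) ∧
      (∀ z ∈ V, ∀ u, P (Y z u) = u) ∧ (∀ z ∈ V, ∀ u, Y z u ∈ kernel (B z)) ∧
      (∀ z ∈ V, ∀ v ∈ kernel (B z), Y z (P v) = v) := by
  have : CompleteSpace E := FiniteDimensional.complete ℝ E
  obtain ⟨W₀, hW⟩ := Submodule.exists_isCompl (kernel (B z₀))
  let K := EuclideanSpace ℝ (Fin (finrank ℝ (kernel (B z₀))))
  let W := EuclideanSpace ℝ (Fin (finrank ℝ W₀))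
  let eK : kernel (B z₀) ≃ₗ[ℝ] K := LinearEquiv.ofFinrankEq _ _ (by simp [K])
  let eW : W ≃ₗ[ℝ] W₀ := LinearEquiv.ofFinrankEq _ _ (by simp [W])
  let iK : K →L[ℝ] E := ((kernel (B z₀)).subtype ∘ₗ eK.symm).toContinuousLinearMap
  let iW : W →L[ℝ] E := (W₀.subtype ∘ₗ eW).toContinuousLinearMap
  have hiW : ∀ w, iW w ∈ W₀ := fun w => (eW w).2
  have hiW_surj : ∀ v ∈ W₀, ∃ w, iW w = v := fun v hv =>
    ⟨eW.symm ⟨v, hv⟩, congrArg Subtype.val (eW.apply_symm_apply ⟨v, hv⟩)⟩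
  have hiW_zero : ∀ w, iW w = 0 → w = 0 := fun w hw => by
    have : eW w = 0 := Subtype.ext hw
    exact eW.map_eq_zero_iff.1 this
  let P : E →L[ℝ] K := (eK ∘ₗ Submodule.projectionOnto _ W₀ hW).toContinuousLinearMap
  have hPK : ∀ u, P (iK u) = u := fun u => by
    change eK (Submodule.projectionOnto _ W₀ hW (eK.symm u : kernel (B z₀))) = u
    rw [Submodule.projectionOnto_apply_left hW, eK.apply_symm_apply]
  have hPW : ∀ v, P v = 0 ↔ v ∈ W₀ := fun v => by
    change eK _ = 0 ↔ _
    rw [eK.map_eq_zero_iff, Submodule.projectionOnto_apply_eq_zero_iff hW]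
  let res : (E →L[ℝ] ℝ) →L[ℝ] (W →L[ℝ] ℝ) := (ContinuousLinearMap.compL ℝ W E ℝ).flip iW
  have hres : ∀ (a : E →L[ℝ] ℝ) (w : W), res a w = a (iW w) := fun _ _ => rfl
  let R : E → E →L[ℝ] (W →L[ℝ] ℝ) := fun z => res ∘L B z
  -- The restriction of `B z` to the fixed complement `W₀`: nondegenerate at `z₀`, hence nearby. Its
  -- inverse depends smoothly on `z` and supplies both `Y` and `Δ`.
  let RW : E → W →L[ℝ] (W →L[ℝ] ℝ) := fun z => R z ∘L iW
  have hR : ContDiffOn ℝ ∞ R U := contDiffOn_const.clm_comp hB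
  have hRW : ContDiffOn ℝ ∞ RW U := hR.clm_comp contDiffOn_const
  have hV : IsOpen (U ∩ RW ⁻¹' {A | A.IsInvertible}) :=
    hRW.continuousOn.isOpen_inter_preimage hU ContinuousLinearEquiv.isOpen
  let Q : E → (W →L[ℝ] ℝ) →L[ℝ] W := fun z => (RW z).inverse
  have hQ : ContDiffOn ℝ ∞ Q (U ∩ RW ⁻¹' {A | A.IsInvertible}) := fun z hz =>
    ((ContinuousLinearMap.IsInvertible.contDiffAt_map_inverse hz.2).comp z
      (hRW.contDiffAt (hU.mem_nhds hz.1))).contDiffWithinAt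
  have hRQ : ∀ z ∈ U ∩ RW ⁻¹' {A | A.IsInvertible}, ∀ (l : W →L[ℝ] ℝ) (w : W),
      B z (iW (Q z l)) (iW w) = l w := by
    rintro z ⟨-, hz⟩ l w
    have h1 : RW z (Q z l) = l := hz.self_apply_inverse l
    exact congrArg (fun T => T w) h1
  have hcompl : ∀ z ∈ U ∩ RW ⁻¹' {A | A.IsInvertible}, IsCompl (kernel (B z)) W₀ := by
    rintro z ⟨hzU, hz⟩
    have hdisj : Disjoint (kernel (B z)) W₀ := by
      rw [Submodule.disjoint_def]
      intro v hvk hvW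
      obtain ⟨w, rfl⟩ := hiW_surj v hvW
      obtain ⟨g, hg⟩ := hz
      have h1 : g w = 0 := by
        have : RW z w = 0 := by
          ext w'
          exact hvk (iW w')
        rw [← this, ← hg]
        rfl
      rw [g.map_eq_zero_iff.1 h1, map_zero]
    -- Constancy of the rank is what turns a trivial intersection into a complement.
    refine (Submodule.isCompl_iff_disjoint _ _ ?_).2 hdisj
    rw [hrank z hzU, Submodule.finrank_add_eq_of_isCompl hW]
  have hYker : ∀ z ∈ U ∩ RW ⁻¹' {A | A.IsInvertible}, ∀ v, (∀ w ∈ W₀, B z v w = 0) →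
      v ∈ kernel (B z) := by
    intro z hz v hv w
    have : w ∈ kernel (B z) ⊔ W₀ := by rw [(hcompl z hz).sup_eq_top]; trivial
    obtain ⟨k, hk, w, hw, rfl⟩ := Submodule.mem_sup.1 this
    rw [map_add, hv w hw, alternating_swap (halt z hz.1), hk v]
    simp
  -- Each vector of the kernel at `z₀` is corrected by the element of `W₀` that cancels its pairing
  -- with `W₀`; `P` does not see the correction.
  let Y : E → K →L[ℝ] E := fun z => iK - iW ∘L Q z ∘L R z ∘L iK
  have hYapply : ∀ z u, Y z u = iK u - iW (Q z (R z (iK u))) := fun _ _ => rfl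
  have hYk : ∀ z ∈ U ∩ RW ⁻¹' {A | A.IsInvertible}, ∀ u, Y z u ∈ kernel (B z) := by
    intro z hz u
    refine hYker z hz _ fun v hv => ?_
    obtain ⟨w, rfl⟩ := hiW_surj v hv
    have h1 := hRQ z hz (R z (iK u)) w
    rw [hYapply, map_sub, sub_apply, h1]
    exact sub_self _
  have hPY : ∀ z u, P (Y z u) = u := by
    intro z u
    rw [hYapply, map_sub, hPK, (hPW _).2 (hiW _), sub_zero]
  -- The Liouville field is the element of `W₀` representing `τ z` on `W₀`; on `kernel (B z)` both
  -- sides of the Liouville equation vanish.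
  refine ⟨_, U ∩ RW ⁻¹' {A | A.IsInvertible}, P, Y, fun z => iW (Q z (res (τ z))), hV,
    ⟨hz₀, ?_⟩, inter_subset_left, ?_, ?_, fun z _ => (hPW _).2 (hiW _), ?_,
    fun z _ u => hPY z u, hYk, ?_⟩
  · have hinj : Function.Injective (RW z₀) := by
      rw [injective_iff_map_eq_zero]
      intro w hw
      refine hiW_zero w (eq_zero_of_mem_compl_kernel (halt z₀ hz₀) hW (hiW w) fun v hv => ?_)
      obtain ⟨w', rfl⟩ := hiW_surj v hv
      exact congrArg (fun T => T w') hw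
    have hfr : finrank ℝ W = finrank ℝ (W →L[ℝ] ℝ) := by
      rw [← (LinearMap.toContinuousLinearMap (𝕜 := ℝ) (E := W) (F' := ℝ)).finrank_eq]
      exact Subspace.dual_finrank_eq.symm
    exact ⟨(LinearEquiv.ofInjectiveOfFinrankEq (RW z₀ : W →ₗ[ℝ] _) hinj
      hfr).toContinuousLinearEquiv, by ext; rfl⟩
  · exact contDiffOn_const.sub (contDiffOn_const.clm_comp (hQ.clm_comp
      ((hR.mono inter_subset_left).clm_comp contDiffOn_const)))
  · exact iW.contDiff.comp_contDiffOn (hQ.clm_apply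
      (res.contDiff.comp_contDiffOn (hτ.mono inter_subset_left)))
  · intro z hz v
    have : v ∈ kernel (B z) ⊔ W₀ := by rw [(hcompl z hz).sup_eq_top]; trivial
    obtain ⟨k, hk, v, hv, rfl⟩ := Submodule.mem_sup.1 this
    obtain ⟨w, rfl⟩ := hiW_surj v hv
    have h1 := hRQ z hz (res (τ z)) w
    have h2 : τ z k = 0 := hker z hz.1 hk
    rw [map_add, map_add, h2, alternating_swap (halt z hz.1), hk, h1, hres, neg_zero]
  · intro z hz v hv
    have h1 : v - Y z (P v) ∈ kernel (B z) := (kernel (B z)).sub_mem hv (hYk z hz _)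
    have h2 : v - Y z (P v) ∈ W₀ := by rw [← hPW, map_sub, hPY, sub_self]
    have h3 := (hcompl z hz).disjoint.le_bot (Submodule.mem_inf.2 ⟨h1, h2⟩)
    exact (sub_eq_zero.1 (by simpa using h3)).symm

omit [FiniteDimensional ℝ E] in
/-- The parametrization `Y` of a distribution by a fixed space commutes at points through which
passes an integral manifold. -/
lemma frame_comm_of_integral_manifold {K F : Type*} [NormedAddCommGroup K] [NormedSpace ℝ K]
    [NormedAddCommGroup F] [NormedSpace ℝ F] {Y : E → K →L[ℝ] E} {P : E →L[ℝ] K} {z : E}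
    (hY : DifferentiableAt ℝ Y z) (hPY : ∀ u, P (Y z u) = u) {ψ : F → E} {q : F}
    (hψ : ContDiffAt ℝ ∞ ψ q) (hψq : ψ q = z)
    (htan : ∀ᶠ q in 𝓝 q, ∀ a, Y (ψ q) (P (fderiv ℝ ψ q a)) = fderiv ℝ ψ q a)
    (hsurj : ∀ u, ∃ a, fderiv ℝ ψ q a = Y z u) (u v : K) :
    fderiv ℝ Y z (Y z u) v = fderiv ℝ Y z (Y z v) u := by
  subst hψq
  have hsymm : IsSymmSndFDerivAt ℝ ψ q := hψ.isSymmSndFDerivAt (by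
    rw [minSmoothness_of_isRCLikeNormedField]; exact WithTop.coe_le_coe.2 le_top)
  have hd : HasFDerivAt ψ (fderiv ℝ ψ q) q := (hψ.differentiableAt (by simp)).hasFDerivAt
  have hdd : HasFDerivAt (fderiv ℝ ψ) (fderiv ℝ (fderiv ℝ ψ) q) q :=
    ((hψ.fderiv_right (m := ∞) (by simp)).differentiableAt (by simp)).hasFDerivAt
  -- Differentiate the tangency relation `Y (P (dψ a)) = dψ a` along `b`. The second derivative of
  -- `ψ` is symmetric, so exchanging `a` and `b` leaves only the commutation of `Y`.
  have key : ∀ a b, fderiv ℝ (fderiv ℝ ψ) q b a =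
      fderiv ℝ Y (ψ q) (fderiv ℝ ψ q b) (P (fderiv ℝ ψ q a)) +
        Y (ψ q) (P (fderiv ℝ (fderiv ℝ ψ) q b a)) := by
    intro a b
    have h1 : HasFDerivAt (fun q => fderiv ℝ ψ q a) _ q := hdd.clm_apply (hasFDerivAt_const a q)
    have h2 := (hY.hasFDerivAt.comp q hd).clm_apply (P.hasFDerivAt.comp q h1)
    have h3 : (fun q => fderiv ℝ ψ q a) =ᶠ[𝓝 q]
        fun q => (Y ∘ ψ) q ((P ∘ fun q => fderiv ℝ ψ q a) q) := by
      filter_upwards [htan] with q hq using (hq a).symm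
    have h4 := congrArg (fun T => T b) (h1.unique (h2.congr_of_eventuallyEq h3))
    simpa [add_comm] using h4
  obtain ⟨a, ha⟩ := hsurj u
  obtain ⟨b, hb⟩ := hsurj v
  have h1 := key a b
  have h2 := key b a
  rw [hsymm.eq a b] at h2
  have h3 := h1.symm.trans h2
  rw [ha, hb, hPY, hPY] at h3
  exact (add_right_cancel h3).symm

omit [FiniteDimensional ℝ E] in
/-- A kernel-valued frame and a Liouville field commute, if their Lie brackets are in the kernel
and the normalizing projection of these brackets vanishes. -/
lemma frame_comm_of_lieBracket {K : Type*} [NormedAddCommGroup K] [NormedSpace ℝ K]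
    {Y : E → K →L[ℝ] E} {Δ : E → E} {P : E →L[ℝ] K} {z : E}
    (hY : DifferentiableAt ℝ Y z) (hΔ : DifferentiableAt ℝ Δ z)
    (hPY : ∀ᶠ z in 𝓝 z, ∀ u, P (Y z u) = u) (hPΔ : ∀ᶠ z in 𝓝 z, P (Δ z) = 0) {u : K}
    (hbr : Y z (P (VectorField.lieBracket ℝ Δ (fun z => Y z u) z)) =
      VectorField.lieBracket ℝ Δ (fun z => Y z u) z) :
    fderiv ℝ Y z (Δ z) u = fderiv ℝ Δ z (Y z u) := by
  have hYu : HasFDerivAt (fun z => Y z u) ((fderiv ℝ Y z).flip u) z := by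
    have := hY.hasFDerivAt.clm_apply (hasFDerivAt_const u z)
    simpa using this
  -- `P` is constant on each of the two fields, so it kills their bracket; `hbr` recovers the
  -- bracket from its image under `P`, hence it is zero.
  have h1 : ∀ v, P (fderiv ℝ Y z v u) = 0 := by
    intro v
    have h2 := P.hasFDerivAt.comp z hYu
    have h3 : P ∘ (fun z => Y z u) =ᶠ[𝓝 z] fun _ => u := by
      filter_upwards [hPY] with z hz using hz u
    exact congrArg (fun T => T v)
      (h2.unique ((hasFDerivAt_const u z).congr_of_eventuallyEq h3))
  have h2 : ∀ v, P (fderiv ℝ Δ z v) = 0 := by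
    intro v
    have h2 := P.hasFDerivAt.comp z hΔ.hasFDerivAt
    have h3 : P ∘ Δ =ᶠ[𝓝 z] fun _ => 0 := hPΔ
    exact congrArg (fun T => T v)
      (h2.unique ((hasFDerivAt_const 0 z).congr_of_eventuallyEq h3))
  rw [VectorField.lieBracket, hYu.fderiv, ContinuousLinearMap.flip_apply, map_sub, h1, h2,
    sub_zero, map_zero] at hbr
  exact sub_eq_zero.1 hbr.symm

/-- Commuting normalized frame and Liouville field yield a function with derivative `0` along the
frame and `-1` along the Liouville field. -/
theorem exists_potential_of_comm {K : Type} [NormedAddCommGroup K] [NormedSpace ℝ K]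
    [FiniteDimensional ℝ K] {V : Set E} (hV : IsOpen V) {Y : E → K →L[ℝ] E} {Δ : E → E}
    {P : E →L[ℝ] K} (hY : ContDiffOn ℝ ∞ Y V) (hΔ : ContDiffOn ℝ ∞ Δ V) {z₀ : E} (hz₀ : z₀ ∈ V)
    (hPY : ∀ u, P (Y z₀ u) = u) (hPΔ : P (Δ z₀) = 0) (hΔ0 : Δ z₀ ≠ 0)
    (hYY : ∀ z ∈ V, ∀ u v, fderiv ℝ Y z (Y z u) v = fderiv ℝ Y z (Y z v) u)
    (hYΔ : ∀ z ∈ V, ∀ u, fderiv ℝ Y z (Δ z) u = fderiv ℝ Δ z (Y z u)) :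
    ∃ (N : Set E) (f : E → ℝ), IsOpen N ∧ z₀ ∈ N ∧ N ⊆ V ∧ ContDiffOn ℝ ∞ f N ∧
      ∀ z ∈ N, (∀ u, fderiv ℝ f z (Y z u) = 0) ∧ fderiv ℝ f z (Δ z) = -1 := by
  let fstA : K × ℝ →L[ℝ] K := ContinuousLinearMap.fst ℝ K ℝ
  let sndA : K × ℝ →L[ℝ] ℝ := ContinuousLinearMap.snd ℝ K ℝ
  -- Frame and Liouville field form one family over `K × ℝ`; the prescribed derivatives are those of
  -- the functional `-sndA`.
  let X : E → K × ℝ →L[ℝ] E := fun z =>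
    Y z ∘L fstA + (ContinuousLinearMap.smulRightL ℝ (K × ℝ) E sndA) (Δ z)
  have hXapply : ∀ z a, X z a = Y z (fstA a) + sndA a • Δ z := fun _ _ => rfl
  have hX : ContDiffOn ℝ ∞ X V := (hY.clm_comp contDiffOn_const).add
    ((ContinuousLinearMap.smulRightL ℝ (K × ℝ) E sndA).contDiff.comp_contDiffOn hΔ)
  have hXd : ∀ z ∈ V, ∀ v a, fderiv ℝ X z v a =
      fderiv ℝ Y z v (fstA a) + sndA a • fderiv ℝ Δ z v := by
    intro z hz v a
    have h1 : HasFDerivAt X (fderiv ℝ X z) z :=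
      ((hX.contDiffAt (hV.mem_nhds hz)).differentiableAt (by simp)).hasFDerivAt
    have h2 : HasFDerivAt Y (fderiv ℝ Y z) z :=
      ((hY.contDiffAt (hV.mem_nhds hz)).differentiableAt (by simp)).hasFDerivAt
    have h3 : HasFDerivAt Δ (fderiv ℝ Δ z) z :=
      ((hΔ.contDiffAt (hV.mem_nhds hz)).differentiableAt (by simp)).hasFDerivAt
    have h4 := h1.clm_apply (hasFDerivAt_const a z)
    have h5 := (h2.clm_apply (hasFDerivAt_const (fstA a) z)).add (h3.const_smul (sndA a))
    simpa using congrArg (fun T => T v) (h4.unique h5)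
  have hinj : Function.Injective (X z₀) := by
    rw [injective_iff_map_eq_zero]
    intro a ha
    rw [hXapply] at ha
    have h1 : fstA a = 0 := by
      have := congrArg P ha
      simpa [hPY, hPΔ] using this
    rw [h1, map_zero, zero_add] at ha
    have h2 : sndA a = 0 := (smul_eq_zero.1 ha).resolve_right hΔ0
    exact Prod.ext h1 h2
  have hcomm : ∀ z ∈ V, ∀ a b, fderiv ℝ X z (X z a) b = fderiv ℝ X z (X z b) a := by
    intro z hz a b
    simp only [hXd z hz, hXapply, map_add, map_smul, add_apply, smul_apply, smul_add]
    rw [hYY z hz (fstA a) (fstA b), hYΔ z hz, hYΔ z hz, smul_comm (sndA a) (sndA b)]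
    abel
  obtain ⟨N, f, hN, hzN, hNV, hf, hfX⟩ := exists_first_integral hV hX hz₀ hinj hcomm (-sndA)
  refine ⟨N, f, hN, hzN, hNV, hf, fun z hz => ⟨fun u => ?_, ?_⟩⟩
  · have := hfX z hz (u, 0)
    rw [hXapply] at this
    simpa [fstA, sndA] using this
  · have := hfX z hz (0, 1)
    rw [hXapply] at this
    simpa [fstA, sndA] using this

end Frame

/-! ### Fields, brackets and forms in a chart. -/

section Chart

variable {m : ℕ} {M : Type*} [TopologicalSpace M] [ChartedSpace (EuclideanSpace ℝ (Fin m)) M]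

/-- The derivative of the inverse of the preferred chart at `x₀`. -/
noncomputable def chartDeriv (x₀ : M) (z : EuclideanSpace ℝ (Fin m)) :
    EuclideanSpace ℝ (Fin m) →L[ℝ] TangentSpace (𝓡 m) ((extChartAt (𝓡 m) x₀).symm z) :=
  mfderiv (𝓡 m) (𝓡 m) (extChartAt (𝓡 m) x₀).symm z

/-- The vector field on `M` represented by `v` in the preferred chart at `x₀`. -/
noncomputable def pushField (x₀ : M) (v : EuclideanSpace ℝ (Fin m) → EuclideanSpace ℝ (Fin m))
    (y : M) : TangentSpace (𝓡 m) y :=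
  (chartDeriv x₀ (extChartAt (𝓡 m) x₀ y) (v (extChartAt (𝓡 m) x₀ y)) : EuclideanSpace ℝ (Fin m))

lemma pushField_symm (x₀ : M) (v : EuclideanSpace ℝ (Fin m) → EuclideanSpace ℝ (Fin m))
    {z : EuclideanSpace ℝ (Fin m)} (hz : z ∈ (extChartAt (𝓡 m) x₀).target) :
    pushField x₀ v ((extChartAt (𝓡 m) x₀).symm z) = chartDeriv x₀ z (v z) :=
  congrArg (fun z' => (chartDeriv x₀ z' (v z') : EuclideanSpace ℝ (Fin m)))
    ((extChartAt (𝓡 m) x₀).right_inv hz)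

variable [IsManifold (𝓡 m) ∞ M]

lemma contMDiffOn_chartDeriv (x₀ : M) {U : Set (EuclideanSpace ℝ (Fin m))}
    (hU : U ⊆ (extChartAt (𝓡 m) x₀).target)
    {v : EuclideanSpace ℝ (Fin m) → EuclideanSpace ℝ (Fin m)} (hv : ContDiffOn ℝ ∞ v U) :
    ContMDiffOn (𝓡 m) (𝓡 m).tangent ∞ (fun z => (⟨(extChartAt (𝓡 m) x₀).symm z,
      chartDeriv x₀ z (v z)⟩ : TangentBundle (𝓡 m) M)) U := by
  have hopen := isOpen_extChartAt_target (I := 𝓡 m) x₀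
  have h1 := (contMDiffOn_extChartAt_symm (I := 𝓡 m) (n := ∞) x₀).contMDiffOn_tangentMapWithin
    (m := ∞) (by simp) hopen.uniqueMDiffOn
  have h2 : ContMDiffOn (𝓡 m) (𝓡 m).tangent ∞
      (fun z => (⟨z, v z⟩ : TangentBundle (𝓡 m) (EuclideanSpace ℝ (Fin m)))) U :=
    contMDiffOn_vectorSpace_iff_contDiffOn.2 hv
  refine (h1.comp h2 fun z hz => hU hz).congr fun z hz => ?_
  simp only [Function.comp_apply, tangentMapWithin, mfderivWithin_of_isOpen hopen (hU hz)]
  rfl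

lemma contMDiffOn_pushField (x₀ : M) {U : Set (EuclideanSpace ℝ (Fin m))}
    (hU : U ⊆ (extChartAt (𝓡 m) x₀).target)
    {v : EuclideanSpace ℝ (Fin m) → EuclideanSpace ℝ (Fin m)} (hv : ContDiffOn ℝ ∞ v U) :
    ContMDiffOn (𝓡 m) (𝓡 m).tangent ∞
      (fun y => (⟨y, pushField x₀ v y⟩ : TangentBundle (𝓡 m) M))
      ((extChartAt (𝓡 m) x₀).source ∩ extChartAt (𝓡 m) x₀ ⁻¹' U) := by
  have h0 : ContMDiffOn (𝓡 m) (𝓡 m) ∞ (extChartAt (𝓡 m) x₀)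
      ((extChartAt (𝓡 m) x₀).source ∩ extChartAt (𝓡 m) x₀ ⁻¹' U) :=
    contMDiffOn_extChartAt.mono fun y hy => by
      rw [← extChartAt_source (𝓡 m)]; exact hy.1
  have h1 := (contMDiffOn_chartDeriv x₀ hU hv).comp h0 fun y hy => hy.2
  refine h1.congr fun y hy => ?_
  have h2 : ∀ y' : M, y = y' → ∀ w : EuclideanSpace ℝ (Fin m),
      (⟨y, w⟩ : TangentBundle (𝓡 m) M) = ⟨y', w⟩ := by
    rintro _ rfl w; rfl
  exact h2 _ ((extChartAt (𝓡 m) x₀).left_inv hy.1).symm _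

lemma isInvertible_chartDeriv (x₀ : M) {z : EuclideanSpace ℝ (Fin m)}
    (hz : z ∈ (extChartAt (𝓡 m) x₀).target) : (chartDeriv x₀ z).IsInvertible := by
  have : IsManifold (𝓡 m) 1 M := IsManifold.of_le (n := ∞) (by simp)
  have h := isInvertible_mfderivWithin_extChartAt_symm (I := 𝓡 m) hz
  rw [ModelWithCorners.range_eq_univ, mfderivWithin_univ] at h
  exact h

lemma mpullback_pushField (x₀ : M) (v : EuclideanSpace ℝ (Fin m) → EuclideanSpace ℝ (Fin m))
    {z : EuclideanSpace ℝ (Fin m)} (hz : z ∈ (extChartAt (𝓡 m) x₀).target) :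
    VectorField.mpullback (𝓡 m) (𝓡 m) (extChartAt (𝓡 m) x₀).symm (pushField x₀ v) z = v z := by
  rw [VectorField.mpullback_apply, pushField_symm x₀ v hz]
  exact (isInvertible_chartDeriv x₀ hz).inverse_apply_self (v z)

/-- The Lie bracket of two fields is represented in a chart by the Lie bracket of their
representatives. -/
lemma mlieBracket_pushField (x₀ : M) {U : Set (EuclideanSpace ℝ (Fin m))} (hUo : IsOpen U)
    (hU : U ⊆ (extChartAt (𝓡 m) x₀).target)
    {v w : EuclideanSpace ℝ (Fin m) → EuclideanSpace ℝ (Fin m)} (hv : ContDiffOn ℝ ∞ v U)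
    (hw : ContDiffOn ℝ ∞ w U) {z : EuclideanSpace ℝ (Fin m)} (hz : z ∈ U) :
    VectorField.mlieBracket (𝓡 m) (pushField x₀ v) (pushField x₀ w)
      ((extChartAt (𝓡 m) x₀).symm z) = chartDeriv x₀ z (VectorField.lieBracket ℝ v w z) := by
  have hopen := isOpen_extChartAt_target (I := 𝓡 m) x₀
  have : IsManifold (𝓡 m) (minSmoothness ℝ 3) M := by
    rw [minSmoothness_of_isRCLikeNormedField]
    exact IsManifold.of_le (n := ∞) (WithTop.coe_le_coe.2 le_top)
  have hO : IsOpen ((extChartAt (𝓡 m) x₀).source ∩ extChartAt (𝓡 m) x₀ ⁻¹' U) :=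
    isOpen_extChartAt_preimage' x₀ hUo
  have hmem : (extChartAt (𝓡 m) x₀).symm z ∈
      (extChartAt (𝓡 m) x₀).source ∩ extChartAt (𝓡 m) x₀ ⁻¹' U :=
    ⟨(extChartAt (𝓡 m) x₀).map_target (hU hz), by
      rw [mem_preimage, (extChartAt (𝓡 m) x₀).right_inv (hU hz)]; exact hz⟩
  have hsm : ∀ {v : EuclideanSpace ℝ (Fin m) → EuclideanSpace ℝ (Fin m)}, ContDiffOn ℝ ∞ v U →
      MDifferentiableAt (𝓡 m) (𝓡 m).tangent
        (fun y => (⟨y, pushField x₀ v y⟩ : TangentBundle (𝓡 m) M))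
        ((extChartAt (𝓡 m) x₀).symm z) := fun hv =>
    ((contMDiffOn_pushField x₀ hU hv).contMDiffAt (hO.mem_nhds hmem)).mdifferentiableAt (by simp)
  have hφ : ContMDiffAt (𝓡 m) (𝓡 m) ∞ (extChartAt (𝓡 m) x₀).symm z :=
    (contMDiffOn_extChartAt_symm (I := 𝓡 m) (n := ∞) x₀).contMDiffAt (hopen.mem_nhds (hU hz))
  -- Brackets are natural under pullback by the inverse chart, and pulling back undoes `pushField`
  -- near `z`.
  have h1 := VectorField.mpullback_mlieBracket (hsm hv) (hsm hw) hφ (by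
    rw [minSmoothness_of_isRCLikeNormedField]; exact WithTop.coe_le_coe.2 le_top)
  have hev : ∀ v : EuclideanSpace ℝ (Fin m) → EuclideanSpace ℝ (Fin m),
      VectorField.mpullback (𝓡 m) (𝓡 m) (extChartAt (𝓡 m) x₀).symm (pushField x₀ v)
        =ᶠ[𝓝 z] v := fun v => by
    filter_upwards [hopen.mem_nhds (hU hz)] with z' hz' using mpullback_pushField x₀ v hz'
  have h2 : VectorField.mlieBracket (𝓡 m) (M := EuclideanSpace ℝ (Fin m)) v w z =
      VectorField.lieBracket ℝ v w z := by
    have := congrFun (VectorField.mlieBracketWithin_eq_lieBracketWithin (𝕜 := ℝ) (V := v)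
      (W := w) (s := univ)) z
    rw [VectorField.lieBracketWithin_univ] at this
    exact this
  have h3 := (h1.trans ((hev v).mlieBracket_vectorField_eq (hev w))).trans h2
  rw [← h3]
  exact ((isInvertible_chartDeriv x₀ (hU hz)).self_apply_inverse _).symm

/-- A `1`-form in the preferred chart at `x₀`. -/
noncomputable def coordOneForm (τ : OneForm m M) (x₀ : M) (z : EuclideanSpace ℝ (Fin m)) :
    EuclideanSpace ℝ (Fin m) →L[ℝ] ℝ :=
  (τ.toFun ((extChartAt (𝓡 m) x₀).symm z)).comp (chartDeriv x₀ z)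

/-- A `2`-form in the preferred chart at `x₀`. -/
noncomputable def coordTwoForm (Ω : TwoForm m M) (x₀ : M) (z : EuclideanSpace ℝ (Fin m)) :
    EuclideanSpace ℝ (Fin m) →L[ℝ] EuclideanSpace ℝ (Fin m) →L[ℝ] ℝ :=
  LinearMap.toContinuousLinearMap
    { toFun := fun v => (Ω.toFun ((extChartAt (𝓡 m) x₀).symm z) (chartDeriv x₀ z v)).comp
        (chartDeriv x₀ z)
      map_add' := fun v w => by
        ext u
        change Ω.toFun _ (chartDeriv x₀ z (v + w)) _ = _
        rw [map_add, map_add]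
        rfl
      map_smul' := fun c v => by
        ext u
        change Ω.toFun _ (chartDeriv x₀ z (c • v)) _ = _
        rw [map_smul, map_smul]
        rfl }

lemma coordOneForm_apply (τ : OneForm m M) (x₀ : M) (z v : EuclideanSpace ℝ (Fin m)) :
    coordOneForm τ x₀ z v = τ.toFun ((extChartAt (𝓡 m) x₀).symm z) (chartDeriv x₀ z v) := rfl

lemma coordTwoForm_apply (Ω : TwoForm m M) (x₀ : M) (z v w : EuclideanSpace ℝ (Fin m)) :
    coordTwoForm Ω x₀ z v w = Ω.toFun ((extChartAt (𝓡 m) x₀).symm z) (chartDeriv x₀ z v)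
      (chartDeriv x₀ z w) := rfl

/-- In finite dimension, smoothness of a family of covectors can be tested on constant vectors,
which `chartDeriv` turns into smooth sections along the inverse chart. -/
lemma contDiffOn_coordOneForm (τ : OneForm m M) (x₀ : M) :
    ContDiffOn ℝ ∞ (coordOneForm τ x₀) (extChartAt (𝓡 m) x₀).target := by
  refine contDiffOn_clm_apply.2 fun v => ?_
  have h1 := τ.smooth.comp_contMDiffOn (contMDiffOn_extChartAt_symm (I := 𝓡 m) (n := ∞) x₀)
  have h2 := contMDiffOn_chartDeriv x₀ subset_rfl (contDiffOn_const (c := v))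
  have h3 := ContMDiffOn.clm_bundle_apply (F₂ := ℝ) (E₂ := Bundle.Trivial M ℝ) h1 h2
  intro z hz
  exact ((Bundle.contMDiffWithinAt_totalSpace.1 (h3 z hz)).2).contDiffWithinAt

lemma contDiffOn_coordTwoForm (Ω : TwoForm m M) (x₀ : M) :
    ContDiffOn ℝ ∞ (coordTwoForm Ω x₀) (extChartAt (𝓡 m) x₀).target := by
  refine contDiffOn_clm_apply.2 fun v => contDiffOn_clm_apply.2 fun w => ?_
  have h1 := Ω.smooth.comp_contMDiffOn (contMDiffOn_extChartAt_symm (I := 𝓡 m) (n := ∞) x₀)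
  have h2 := fun v => contMDiffOn_chartDeriv (m := m) x₀ subset_rfl (contDiffOn_const (c := v))
  have h3 := ContMDiffOn.clm_bundle_apply₂ (F₃ := ℝ) (E₃ := Bundle.Trivial M ℝ) h1 (h2 v) (h2 w)
  intro z hz
  exact ((Bundle.contMDiffWithinAt_totalSpace.1 (h3 z hz)).2).contDiffWithinAt

end Chart

/-! ### From local fields to global fields. -/

section Global

variable {m : ℕ} {M : Type*} [TopologicalSpace M]
  [ChartedSpace (EuclideanSpace ℝ (Fin m)) M] [IsManifold (𝓡 m) ∞ M]

/-- A local vector field with values in convex sets is near each point the restriction of a global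
one, if there are local vector fields of this kind near every point. -/
lemma exists_global_vectorField [T2Space M] [SecondCountableTopology M]
    (t : ∀ x : M, Set (TangentSpace (𝓡 m) x))
    (ht : ∀ x, Convex ℝ (t x))
    (hloc : ∀ x : M, ∃ N ∈ 𝓝 x, ∃ s : ∀ y : M, TangentSpace (𝓡 m) y,
      ContMDiffOn (𝓡 m) (𝓡 m).tangent ∞ (fun y => (⟨y, s y⟩ : TangentBundle (𝓡 m) M)) N ∧
        ∀ y ∈ N, s y ∈ t y)
    {x : M} {N : Set M} (hN : N ∈ 𝓝 x) {s : ∀ y : M, TangentSpace (𝓡 m) y}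
    (hs : ContMDiffOn (𝓡 m) (𝓡 m).tangent ∞ (fun y => (⟨y, s y⟩ : TangentBundle (𝓡 m) M)) N)
    (hst : ∀ y ∈ N, s y ∈ t y) :
    ∃ X : ∀ y : M, TangentSpace (𝓡 m) y, IsSmoothVectorField X ∧ (∀ y, X y ∈ t y) ∧
      X =ᶠ[𝓝 x] s := by
  have : LocallyCompactSpace M := Manifold.locallyCompact_of_finiteDimensional (𝓡 m)
  have : IsManifold (𝓡 m) 1 M := IsManifold.of_le (n := ∞) (by simp)
  obtain ⟨C, ⟨hCx, hC⟩, hCN⟩ := (closed_nhds_basis x).mem_iff.1 (interior_mem_nhds.2 hN)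
  -- Agreement with `s` on a closed neighbourhood of `x` is itself a convex condition, so a single
  -- partition of unity serves both requirements. Off `C` it is vacuous on an open set.
  let t' : ∀ y : M, Set (TangentSpace (𝓡 m) y) := fun y => {v | v ∈ t y ∧ (y ∈ C → v = s y)}
  have ht' : ∀ y, Convex ℝ (t' y) := by
    rintro y v ⟨hv, hvC⟩ w ⟨hw, hwC⟩ a b ha hb hab
    refine ⟨ht y hv hw ha hb hab, fun hy => ?_⟩
    rw [hvC hy, hwC hy]
    exact Convex.combo_self hab _
  obtain ⟨X, hX⟩ := exists_contMDiffSection_forall_mem_convex_of_local (n := (⊤ : ℕ∞)) (𝓡 m)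
    (TangentSpace (𝓡 m) : M → Type) t' ht' (fun y => by
      by_cases hy : y ∈ C
      · exact ⟨N, mem_interior_iff_mem_nhds.1 (hCN hy), s, hs, fun z hz => ⟨hst z hz, fun _ => rfl⟩⟩
      · obtain ⟨N', hN', s', hs', hst'⟩ := hloc y
        exact ⟨N' ∩ Cᶜ, inter_mem hN' (hC.isOpen_compl.mem_nhds hy), s',
          hs'.mono inter_subset_left, fun z hz => ⟨hst' z hz.1, fun h => absurd h hz.2⟩⟩)
  exact ⟨X, X.contMDiff, fun y => (hX y).1, by filter_upwards [hCx] with y hy using (hX y).2 hy⟩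

variable {τ : OneForm m M} {Ω : TwoForm m M}

lemma coordTwoForm_self (Ω : TwoForm m M) (x₀ : M) (z v : EuclideanSpace ℝ (Fin m)) :
    coordTwoForm Ω x₀ z v v = 0 :=
  Ω.alternating _ _

lemma mem_kernel_coordTwoForm (Ω : TwoForm m M) (x₀ : M) {z : EuclideanSpace ℝ (Fin m)}
    (hz : z ∈ (extChartAt (𝓡 m) x₀).target) (v : EuclideanSpace ℝ (Fin m)) :
    v ∈ kernel (coordTwoForm Ω x₀ z) ↔
      chartDeriv x₀ z v ∈ kernel (Ω.toFun ((extChartAt (𝓡 m) x₀).symm z)) := by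
  obtain ⟨g, hg⟩ := isInvertible_chartDeriv x₀ hz
  constructor
  · intro h w
    have h1 := h (g.symm w)
    rw [coordTwoForm_apply] at h1
    have h2 : chartDeriv x₀ z (g.symm w) = w := by
      rw [← hg]; exact g.apply_symm_apply w
    rwa [h2] at h1
  · intro h w
    exact h _

lemma finrank_kernel_coordTwoForm (Ω : TwoForm m M) (x₀ : M) {z : EuclideanSpace ℝ (Fin m)}
    (hz : z ∈ (extChartAt (𝓡 m) x₀).target) :
    finrank ℝ (kernel (coordTwoForm Ω x₀ z)) =
      finrank ℝ (kernel (Ω.toFun ((extChartAt (𝓡 m) x₀).symm z))) := by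
  obtain ⟨g, hg⟩ := isInvertible_chartDeriv x₀ hz
  have h : (kernel (coordTwoForm Ω x₀ z)).map (g.toLinearEquiv : _ →ₗ[ℝ] _) =
      kernel (Ω.toFun ((extChartAt (𝓡 m) x₀).symm z)) := by
    ext w
    constructor
    · rintro ⟨v, hv, rfl⟩
      have := (mem_kernel_coordTwoForm Ω x₀ hz v).1 hv
      rw [← hg] at this
      exact this
    · intro hw
      refine ⟨g.symm w, (mem_kernel_coordTwoForm Ω x₀ hz _).2 ?_, g.apply_symm_apply w⟩
      rw [← hg]
      convert hw using 1
      exact g.apply_symm_apply w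
  rw [← h]
  exact (g.toLinearEquiv.finrank_map_eq _).symm

/-- Even class forces the inclusion, so the class is the rank of `Ω`; the resulting constancy of the
kernel dimension is what the smooth frame needs. -/
lemma finrank_kernel_add {r : ℕ} (hclass : IsDoubletOfClass τ Ω (2 * r + 2)) (x : M) :
    kernel (Ω.toFun x) ≤ kernelCovector (τ.toFun x) ∧
      2 * r + 2 + finrank ℝ (kernel (Ω.toFun x)) = m := by
  have : FiniteDimensional ℝ (TangentSpace (𝓡 m) x) :=
    inferInstanceAs (FiniteDimensional ℝ (EuclideanSpace ℝ (Fin m)))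
  have h1 : kernel (Ω.toFun x) ≤ kernelCovector (τ.toFun x) :=
    kernel_le_kernelCovector (Ω.alternating x) (by rw [hclass x]; exact ⟨r + 1, by ring⟩)
  refine ⟨h1, ?_⟩
  have h2 := hclass x
  rw [pairClass, inf_eq_right.2 h1] at h2
  rw [← h2, Submodule.finrank_quotient_add_finrank]
  exact finrank_euclideanSpace_fin (𝕜 := ℝ)

/-- The normalized frame of the kernel of `Ω` and the normalized Liouville field in a chart. -/
lemma exists_chart_frame {r : ℕ} (hclass : IsDoubletOfClass τ Ω (2 * r + 2)) (x₀ : M) :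
    ∃ (k : ℕ) (V : Set (EuclideanSpace ℝ (Fin m)))
      (P : EuclideanSpace ℝ (Fin m) →L[ℝ] EuclideanSpace ℝ (Fin k))
      (Y : EuclideanSpace ℝ (Fin m) → EuclideanSpace ℝ (Fin k) →L[ℝ] EuclideanSpace ℝ (Fin m))
      (Δ : EuclideanSpace ℝ (Fin m) → EuclideanSpace ℝ (Fin m)),
      IsOpen V ∧ extChartAt (𝓡 m) x₀ x₀ ∈ V ∧ V ⊆ (extChartAt (𝓡 m) x₀).target ∧
      ContDiffOn ℝ ∞ Y V ∧ ContDiffOn ℝ ∞ Δ V ∧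
      (∀ z ∈ V, P (Δ z) = 0) ∧
      (∀ z ∈ V, ∀ w, coordTwoForm Ω x₀ z (Δ z) w = coordOneForm τ x₀ z w) ∧
      (∀ z ∈ V, ∀ u, P (Y z u) = u) ∧
      (∀ z ∈ V, ∀ u, Y z u ∈ kernel (coordTwoForm Ω x₀ z)) ∧
      (∀ z ∈ V, ∀ v ∈ kernel (coordTwoForm Ω x₀ z), Y z (P v) = v) := by
  refine exists_adapted_frame (isOpen_extChartAt_target x₀) (contDiffOn_coordTwoForm Ω x₀)
    (contDiffOn_coordOneForm τ x₀) (fun z _ => coordTwoForm_self Ω x₀ z) ?_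
    (mem_extChartAt_target x₀) ?_
  · intro z hz v hv
    exact (finrank_kernel_add hclass _).1 ((mem_kernel_coordTwoForm Ω x₀ hz v).1 hv)
  · intro z hz
    rw [finrank_kernel_coordTwoForm Ω x₀ hz,
      finrank_kernel_coordTwoForm Ω x₀ (mem_extChartAt_target x₀)]
    have h1 := (finrank_kernel_add hclass ((extChartAt (𝓡 m) x₀).symm z)).2
    have h2 := (finrank_kernel_add hclass
      ((extChartAt (𝓡 m) x₀).symm (extChartAt (𝓡 m) x₀ x₀))).2
    omega

/-- A vector field in a chart solving the Liouville equation there induces a local solution. -/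
lemma pushField_liouville (x₀ : M) {Δ : EuclideanSpace ℝ (Fin m) → EuclideanSpace ℝ (Fin m)}
    {V : Set (EuclideanSpace ℝ (Fin m))} (hV : V ⊆ (extChartAt (𝓡 m) x₀).target)
    (hΔ : ∀ z ∈ V, ∀ w, coordTwoForm Ω x₀ z (Δ z) w = coordOneForm τ x₀ z w) {y : M}
    (hy : y ∈ (extChartAt (𝓡 m) x₀).source ∩ extChartAt (𝓡 m) x₀ ⁻¹' V)
    (w : TangentSpace (𝓡 m) y) : Ω.toFun y (pushField x₀ Δ y) w = τ.toFun y w := by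
  obtain ⟨z, hz, rfl⟩ : ∃ z ∈ V, (extChartAt (𝓡 m) x₀).symm z = y :=
    ⟨_, hy.2, (extChartAt (𝓡 m) x₀).left_inv hy.1⟩
  rw [pushField_symm x₀ Δ (hV hz)]
  obtain ⟨g, hg⟩ := isInvertible_chartDeriv x₀ (hV hz)
  have h1 : chartDeriv x₀ z (g.symm w) = w := by rw [← hg]; exact g.apply_symm_apply w
  rw [← h1]
  exact hΔ z hz _

lemma pushField_mem_kernel (x₀ : M) {v : EuclideanSpace ℝ (Fin m) → EuclideanSpace ℝ (Fin m)}
    {V : Set (EuclideanSpace ℝ (Fin m))} (hV : V ⊆ (extChartAt (𝓡 m) x₀).target)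
    (hv : ∀ z ∈ V, v z ∈ kernel (coordTwoForm Ω x₀ z)) {y : M}
    (hy : y ∈ (extChartAt (𝓡 m) x₀).source ∩ extChartAt (𝓡 m) x₀ ⁻¹' V) :
    pushField x₀ v y ∈ kernel (Ω.toFun y) := by
  obtain ⟨z, hz, rfl⟩ : ∃ z ∈ V, (extChartAt (𝓡 m) x₀).symm z = y :=
    ⟨_, hy.2, (extChartAt (𝓡 m) x₀).left_inv hy.1⟩
  rw [pushField_symm x₀ v (hV hz)]
  exact (mem_kernel_coordTwoForm Ω x₀ (hV hz) _).1 (hv z hz)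

omit [IsManifold (𝓡 m) ∞ M] in
lemma preimage_mem_nhds (x₀ : M) {V : Set (EuclideanSpace ℝ (Fin m))} (hVo : IsOpen V)
    (hV : V ⊆ (extChartAt (𝓡 m) x₀).target) {z : EuclideanSpace ℝ (Fin m)} (hz : z ∈ V) :
    (extChartAt (𝓡 m) x₀).source ∩ extChartAt (𝓡 m) x₀ ⁻¹' V ∈
      𝓝 ((extChartAt (𝓡 m) x₀).symm z) :=
  (isOpen_extChartAt_preimage' x₀ hVo).mem_nhds ⟨(extChartAt (𝓡 m) x₀).map_target (hV hz), by
    rw [mem_preimage, (extChartAt (𝓡 m) x₀).right_inv (hV hz)]; exact hz⟩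

/-- The bracket hypothesis on global fields gives the same for fields given in a chart. -/
lemma lieBracket_mem_kernel [T2Space M] [SecondCountableTopology M] {r : ℕ}
    (hclass : IsDoubletOfClass τ Ω (2 * r + 2))
    (hbracket : ∀ Δ Γ : (∀ x : M, TangentSpace (𝓡 m) x), IsLiouville τ Ω Δ →
      IsSmoothVectorField Γ → (∀ x : M, Γ x ∈ kernel (Ω.toFun x)) →
      ∀ x : M, VectorField.mlieBracket (𝓡 m) Δ Γ x ∈ kernel (Ω.toFun x))
    (x₀ : M) {V : Set (EuclideanSpace ℝ (Fin m))} (hVo : IsOpen V)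
    (hV : V ⊆ (extChartAt (𝓡 m) x₀).target)
    {Δ Γ : EuclideanSpace ℝ (Fin m) → EuclideanSpace ℝ (Fin m)} (hΔ : ContDiffOn ℝ ∞ Δ V)
    (hΔL : ∀ z ∈ V, ∀ w, coordTwoForm Ω x₀ z (Δ z) w = coordOneForm τ x₀ z w)
    (hΓ : ContDiffOn ℝ ∞ Γ V) (hΓk : ∀ z ∈ V, Γ z ∈ kernel (coordTwoForm Ω x₀ z))
    {z : EuclideanSpace ℝ (Fin m)} (hz : z ∈ V) :
    VectorField.lieBracket ℝ Δ Γ z ∈ kernel (coordTwoForm Ω x₀ z) := by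
  have hnhds := preimage_mem_nhds x₀ hVo hV hz
  -- Solutions of `ι_v Ω = τ` at a point form an affine space, and chart frames provide local
  -- solutions everywhere. Brackets are local, so the global extensions have the bracket of the
  -- given fields at `z`.
  obtain ⟨Δ', hΔ's, hΔ't, hΔ'eq⟩ := exists_global_vectorField
    (fun y => {v | ∀ w, Ω.toFun y v w = τ.toFun y w}) (fun y v hv v' hv' a b _ _ hab w => by
      rw [map_add, map_smul, map_smul, add_apply, smul_apply, smul_apply, hv w, hv' w]
      exact Convex.combo_self hab _)
    (fun x => by
      obtain ⟨k, V', P, Y, D, hVo', hx, hV', -, hD, -, hDL, -⟩ := exists_chart_frame hclass x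
      refine ⟨_, ?_, pushField x D, contMDiffOn_pushField x hV' hD,
        fun y hy => pushField_liouville x hV' hDL hy⟩
      have := preimage_mem_nhds x hVo' hV' hx
      rwa [extChartAt_to_inv] at this)
    hnhds (contMDiffOn_pushField x₀ hV hΔ) (fun y hy => pushField_liouville x₀ hV hΔL hy)
  obtain ⟨Γ', hΓ's, hΓ't, hΓ'eq⟩ := exists_global_vectorField
    (fun y => (kernel (Ω.toFun y) : Set (TangentSpace (𝓡 m) y)))
    (fun y => (kernel (Ω.toFun y)).convex)
    (fun x => ⟨univ, univ_mem, fun _ => 0, (Bundle.contMDiff_zeroSection ℝ _).contMDiffOn,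
      fun y _ => (kernel (Ω.toFun y)).zero_mem⟩)
    hnhds (contMDiffOn_pushField x₀ hV hΓ) (fun y hy => pushField_mem_kernel x₀ hV hΓk hy)
  have h1 := hbracket Δ' Γ' ⟨hΔ's, hΔ't⟩ hΓ's hΓ't ((extChartAt (𝓡 m) x₀).symm z)
  rw [hΔ'eq.mlieBracket_vectorField_eq hΓ'eq, mlieBracket_pushField x₀ hVo hV hΔ hΓ hz] at h1
  exact (mem_kernel_coordTwoForm Ω x₀ (hV hz) _).2 h1

end Global

/-! ### Integrability in a chart, and the theorem. -/

section Main

variable {m : ℕ} {M : Type*} [TopologicalSpace M]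
  [ChartedSpace (EuclideanSpace ℝ (Fin m)) M] [IsManifold (𝓡 m) ∞ M]
  {τ : OneForm m M} {Ω : TwoForm m M}

/-- Integrability of the kernel makes its normalized frame in a chart commute. -/
lemma chart_frame_comm (hint : IsIntegrable (fun x : M => kernel (Ω.toFun x))) (x₀ : M) {k : ℕ}
    {V : Set (EuclideanSpace ℝ (Fin m))} (hVo : IsOpen V)
    (hV : V ⊆ (extChartAt (𝓡 m) x₀).target)
    {P : EuclideanSpace ℝ (Fin m) →L[ℝ] EuclideanSpace ℝ (Fin k)}
    {Y : EuclideanSpace ℝ (Fin m) → EuclideanSpace ℝ (Fin k) →L[ℝ] EuclideanSpace ℝ (Fin m)}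
    (hY : ContDiffOn ℝ ∞ Y V) (hPY : ∀ z ∈ V, ∀ u, P (Y z u) = u)
    (hYk : ∀ z ∈ V, ∀ u, Y z u ∈ kernel (coordTwoForm Ω x₀ z))
    (hYP : ∀ z ∈ V, ∀ v ∈ kernel (coordTwoForm Ω x₀ z), Y z (P v) = v)
    {z : EuclideanSpace ℝ (Fin m)} (hz : z ∈ V) (u v : EuclideanSpace ℝ (Fin k)) :
    fderiv ℝ Y z (Y z u) v = fderiv ℝ Y z (Y z v) u := by
  obtain ⟨n, U, φ, hU, h0, hφ0, hφ, hφt⟩ := hint ((extChartAt (𝓡 m) x₀).symm z)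
  let O : Set M := (extChartAt (𝓡 m) x₀).source ∩ extChartAt (𝓡 m) x₀ ⁻¹' V
  have hO : IsOpen O := isOpen_extChartAt_preimage' x₀ hVo
  have hφO : φ 0 ∈ O := by
    rw [hφ0]; exact mem_of_mem_nhds (preimage_mem_nhds x₀ hVo hV hz)
  have hUO : IsOpen (U ∩ φ ⁻¹' O) := hφ.continuousOn.isOpen_inter_preimage hU hO
  -- The integral manifold read in the chart; `hchain` transfers its tangency from `φ` to `ψ`.
  let ψ : EuclideanSpace ℝ (Fin n) → EuclideanSpace ℝ (Fin m) := extChartAt (𝓡 m) x₀ ∘ φ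
  have hψz : ψ 0 = z := by
    simp only [ψ, Function.comp_apply, hφ0]
    exact (extChartAt (𝓡 m) x₀).right_inv (hV hz)
  have hψ : ContDiffOn ℝ ∞ ψ (U ∩ φ ⁻¹' O) := by
    refine contMDiffOn_iff_contDiffOn.1 ?_
    refine (contMDiffOn_extChartAt (I := 𝓡 m) (n := ∞) (x := x₀)).comp
      (hφ.mono inter_subset_left) fun q hq => ?_
    rw [← extChartAt_source (𝓡 m)]; exact hq.2.1
  have hφq : ∀ q ∈ U ∩ φ ⁻¹' O, (extChartAt (𝓡 m) x₀).symm (ψ q) = φ q := fun q hq =>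
    (extChartAt (𝓡 m) x₀).left_inv hq.2.1
  have hchain : ∀ q ∈ U ∩ φ ⁻¹' O, ∀ a : EuclideanSpace ℝ (Fin n),
      (chartDeriv x₀ (ψ q) (fderiv ℝ ψ q a) : EuclideanSpace ℝ (Fin m)) =
        mfderiv (𝓡 n) (𝓡 m) φ q a := by
    intro q hq a
    have h1 : φ =ᶠ[𝓝 q] (extChartAt (𝓡 m) x₀).symm ∘ ψ := by
      filter_upwards [hUO.mem_nhds hq] with q' hq' using (hφq q' hq').symm
    have h2 : MDifferentiableAt (𝓡 m) (𝓡 m) (extChartAt (𝓡 m) x₀).symm (ψ q) :=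
      ((contMDiffOn_extChartAt_symm (I := 𝓡 m) (n := ∞) x₀).contMDiffAt
        ((isOpen_extChartAt_target x₀).mem_nhds (hV hq.2.2))).mdifferentiableAt (by simp)
    have h3 : MDifferentiableAt (𝓡 n) (𝓡 m) ψ q :=
      ((hψ.contDiffAt (hUO.mem_nhds hq)).differentiableAt (by simp)).mdifferentiableAt
    have h4 := mfderiv_comp q h2 h3
    rw [mfderiv_eq_fderiv] at h4
    have h5 := h1.mfderiv_eq (I := 𝓡 n) (I' := 𝓡 m)
    exact congrArg (fun T : EuclideanSpace ℝ (Fin n) →L[ℝ] EuclideanSpace ℝ (Fin m) => T a)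
      (h5.trans h4).symm
  have hform : ∀ (y y' : M) (_ : y = y') (v : EuclideanSpace ℝ (Fin m)),
      (v : TangentSpace (𝓡 m) y) ∈ kernel (Ω.toFun y) ↔
        (v : TangentSpace (𝓡 m) y') ∈ kernel (Ω.toFun y') := by
    rintro y _ rfl v; rfl
  have hmemq : (0 : EuclideanSpace ℝ (Fin n)) ∈ U ∩ φ ⁻¹' O := ⟨h0, hφO⟩
  refine frame_comm_of_integral_manifold (P := P)
    ((hY.contDiffAt (hVo.mem_nhds hz)).differentiableAt (by simp)) (hPY z hz)
    (hψ.contDiffAt (hUO.mem_nhds hmemq)) hψz ?_ ?_ u v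
  · filter_upwards [hUO.mem_nhds hmemq] with q hq a
    refine hYP _ hq.2.2 _ ((mem_kernel_coordTwoForm Ω x₀ (hV hq.2.2) _).2 ?_)
    exact (hform _ _ (hφq q hq) _).2 (((hφt q hq.1).2 _).2 ⟨a, (hchain q hq a).symm⟩)
  · intro u
    have h1 := (mem_kernel_coordTwoForm Ω x₀ (hV hz) _).1 (hYk z hz u)
    obtain ⟨a, ha⟩ := ((hφt 0 h0).2 _).1 ((hform _ _ hφ0.symm _).1 h1)
    have h2 := hchain 0 hmemq a
    rw [hψz] at h2
    refine ⟨a, ?_⟩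
    obtain ⟨g, hg⟩ := isInvertible_chartDeriv x₀ (hV hz)
    refine g.injective ?_
    have h3 : ∀ v, g v = chartDeriv x₀ z v := fun v => by rw [← hg]; rfl
    rw [h3, h3]
    exact h2.trans ha

end Main

end Doublet

theorem mainTheorem6 (m r : ℕ) (M : Type*) [TopologicalSpace M] [T2Space M]
    [SecondCountableTopology M] [ChartedSpace (EuclideanSpace ℝ (Fin m)) M]
    [IsManifold (𝓡 m) ∞ M]
    (τ : Doublet.OneForm m M) (Ω : Doublet.TwoForm m M)
    (hclass : Doublet.IsDoubletOfClass τ Ω (2 * r + 2))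
    (hτ : ∀ x : M, τ.toFun x ≠ 0)
    (hint : Doublet.IsIntegrable (fun x : M => Doublet.kernel (Ω.toFun x)))
    (hbracket : ∀ Δ Γ : (∀ x : M, TangentSpace (𝓡 m) x),
      Doublet.IsLiouville τ Ω Δ → Doublet.IsSmoothVectorField Γ →
      (∀ x : M, Γ x ∈ Doublet.kernel (Ω.toFun x)) →
      ∀ x : M, VectorField.mlieBracket (𝓡 m) Δ Γ x ∈ Doublet.kernel (Ω.toFun x)) :
    ∀ x : M, ∃ (V : Set M) (g : M → ℝ), IsOpen V ∧ x ∈ V ∧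
      ContMDiffOn (𝓡 m) 𝓘(ℝ, ℝ) ∞ g V ∧ (∀ y ∈ V, g y ≠ 0) ∧
      ∀ y ∈ V, Doublet.pairClass (g y • τ.toFun y)
        (Doublet.wedge (Doublet.differential g y) (τ.toFun y) + g y • Ω.toFun y) = 2 * r + 1 := by
  intro x₀
  obtain ⟨k, V, P, Y, Δ, hVo, hxV, hV, hY, hΔ, hPΔ, hΔL, hPY, hYk, hYP⟩ :=
    Doublet.exists_chart_frame hclass x₀
  have hYY : ∀ z ∈ V, ∀ u v, fderiv ℝ Y z (Y z u) v = fderiv ℝ Y z (Y z v) u :=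
    fun z hz => Doublet.chart_frame_comm hint x₀ hVo hV hY hPY hYk hYP hz
  have hYΔ : ∀ z ∈ V, ∀ u, fderiv ℝ Y z (Δ z) u = fderiv ℝ Δ z (Y z u) := by
    intro z hz u
    refine Doublet.frame_comm_of_lieBracket (P := P)
      ((hY.contDiffAt (hVo.mem_nhds hz)).differentiableAt (by simp))
      ((hΔ.contDiffAt (hVo.mem_nhds hz)).differentiableAt (by simp))
      (by filter_upwards [hVo.mem_nhds hz] with z' hz' using hPY z' hz')
      (by filter_upwards [hVo.mem_nhds hz] with z' hz' using hPΔ z' hz') (hYP z hz _ ?_)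
    exact Doublet.lieBracket_mem_kernel hclass hbracket x₀ hVo hV hΔ hΔL
      (hY.clm_apply contDiffOn_const) (fun z' hz' => hYk z' hz' u) hz
  have hΔ0 : Δ (extChartAt (𝓡 m) x₀ x₀) ≠ 0 := by
    intro h
    apply hτ ((extChartAt (𝓡 m) x₀).symm (extChartAt (𝓡 m) x₀ x₀))
    ext w
    obtain ⟨e, he⟩ := Doublet.isInvertible_chartDeriv x₀ (hV hxV)
    have h1 := hΔL _ hxV (e.symm w)
    rw [h, map_zero, Doublet.coordOneForm_apply, ← he] at h1
    exact (h1.trans (congrArg _ (e.apply_symm_apply w))).symm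
  obtain ⟨N, f, hNo, hxN, hNV, hf, hfd⟩ := Doublet.exists_potential_of_comm hVo hY hΔ hxV
    (hPY _ hxV) (hPΔ _ hxV) hΔ0 hYY hYΔ
  have hNt := hNV.trans hV
  -- The exponential turns `df Δ = -1` into `dg Δ = -g` and makes `g` nowhere zero.
  let g : M → ℝ := fun y => Real.exp (f (extChartAt (𝓡 m) x₀ y))
  have hg : ContMDiffOn (𝓡 m) 𝓘(ℝ, ℝ) ∞ g
      ((extChartAt (𝓡 m) x₀).source ∩ extChartAt (𝓡 m) x₀ ⁻¹' N) := by
    refine (Real.contDiff_exp.comp_contDiffOn hf).contMDiffOn.comp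
      (contMDiffOn_extChartAt.mono fun y hy => ?_) fun y hy => hy.2
    rw [← extChartAt_source (𝓡 m)]; exact hy.1
  have hO : IsOpen ((extChartAt (𝓡 m) x₀).source ∩ extChartAt (𝓡 m) x₀ ⁻¹' N) :=
    isOpen_extChartAt_preimage' x₀ hNo
  refine ⟨_, g, hO, ⟨mem_extChartAt_source x₀, hxN⟩, hg, fun y _ => Real.exp_ne_zero _, ?_⟩
  rintro y ⟨hyS, hyN⟩
  obtain ⟨z, hz, rfl⟩ : ∃ z ∈ N, (extChartAt (𝓡 m) x₀).symm z = y :=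
    ⟨_, hyN, (extChartAt (𝓡 m) x₀).left_inv hyS⟩
  obtain ⟨e, he⟩ := Doublet.isInvertible_chartDeriv x₀ (hNt hz)
  have hdg : ∀ v, Doublet.differential g ((extChartAt (𝓡 m) x₀).symm z)
      (Doublet.chartDeriv x₀ z v) = Real.exp (f z) * fderiv ℝ f z v := by
    intro v
    have h1 : MDifferentiableAt (𝓡 m) 𝓘(ℝ, ℝ) g ((extChartAt (𝓡 m) x₀).symm z) :=
      (hg.contMDiffAt (hO.mem_nhds ⟨hyS, hyN⟩)).mdifferentiableAt (by simp)
    have h2 : MDifferentiableAt (𝓡 m) (𝓡 m) (extChartAt (𝓡 m) x₀).symm z :=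
      ((contMDiffOn_extChartAt_symm (I := 𝓡 m) (n := ∞) x₀).contMDiffAt
        ((isOpen_extChartAt_target x₀).mem_nhds (hNt hz))).mdifferentiableAt (by simp)
    have h3 := mfderiv_comp z h1 h2
    have h4 : g ∘ (extChartAt (𝓡 m) x₀).symm =ᶠ[nhds z] fun z => Real.exp (f z) := by
      filter_upwards [hNo.mem_nhds hz] with z' hz'
      simp only [Function.comp_apply, g, (extChartAt (𝓡 m) x₀).right_inv (hNt hz')]
    have h5 : HasFDerivAt f (fderiv ℝ f z) z :=
      ((hf.contDiffAt (hNo.mem_nhds hz)).differentiableAt (by simp)).hasFDerivAt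
    rw [h4.mfderiv_eq, mfderiv_eq_fderiv, h5.exp.fderiv] at h3
    exact (congrArg (fun T : EuclideanSpace ℝ (Fin m) →L[ℝ] ℝ => T v) h3).symm
  have : FiniteDimensional ℝ (TangentSpace (𝓡 m) ((extChartAt (𝓡 m) x₀).symm z)) :=
    inferInstanceAs (FiniteDimensional ℝ (EuclideanSpace ℝ (Fin m)))
  have hsurj : ∀ w, Doublet.chartDeriv x₀ z (e.symm w) = w := fun w => by
    rw [← he]; exact e.apply_symm_apply w
  refine Doublet.pairClass_rescale (D := Doublet.chartDeriv x₀ z (Δ z)) (Ω.alternating _) (hτ _)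
    (fun w => ?_) (hclass _) (Real.exp_ne_zero _) (fun w hw => ?_) ?_
  · rw [← hsurj w]
    exact hΔL z (hNV hz) _
  · rw [← hsurj w] at hw ⊢
    -- Every kernel vector is a value of the frame, along which `f` has zero derivative.
    have h1 := hYP z (hNV hz) _ ((Doublet.mem_kernel_coordTwoForm Ω x₀ (hNt hz) _).2 hw)
    rw [hdg, ← h1, (hfd z hz).1, mul_zero]
  · rw [hdg, (hfd z hz).2, (extChartAt (𝓡 m) x₀).right_inv (hNt hz)]
    ring
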